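/- Let $v:[0,1]\to\mathbb{R}$ be Lipschitz with Lipschitz constant $L$, with $v(1)=0$ and $v'(\rho)\le c<0$ for a.e. $\rho\in[0,1]$, for some constant $c$. For $N\ge 1$ let $l=1/N$. A solution of the Follow-the-Leader (FtL) system with $N+1$ vehicles is a family $x^N_0,\dots,x^N_N:[0,+\infty)\to\mathbb{R}$ with $$\dot x^N_j=v\Big(\frac{l}{x^N_{j+1}-x^N_j}\Big)\quad (0\le j\le N-1),\qquad \dot x^N_N=v(0),\qquad x^N_{j+1}(0)-x^N_j(0)\ge l\quad(0\le j\le N-1).$$ Its Eulerian discrete density is $$\rho^{E,N}(t,x)=\sum_{j=0}^{N-1}\frac{l}{x^N_{j+1}(t)-x^N_j(t)}\,\chi_{[x^N_j(t),x^N_{j+1}(t))}(x),\qquad x\in\mathbb{R}.$$ For compactly supported probability measures on $\mathbb{R}$, let $W_1(\mu,\nu)=\|F_\mu-F_\nu\|_{L^1(\mathbb{R})}$ be the 1-Wasserstein distance, with $F_\mu(x)=\mu((-\infty,x])$. For every $N\ge1$ let $\{x^N_j\}_{j=0}^N$ and $\{\tilde x^N_j\}_{j=0}^N$ be solutions of the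 FtL system, with Eulerian discrete densities $\rho^{E,N}$ and $\tilde\rho^{E,N}$, such that the initial positions $x^N_j(0)$ and $\tilde x^N_j(0)$, for all $N$ and $j$, lie in a bounded set independent of $N$. Put $$S_N=\sum_{j=0}^{N-1}\big|x^N_{j+1}(0)-x^N_j(0)-(\tilde x^N_{j+1}(0)-\tilde x^N_j(0))\big|.$$ Then for all $T>0$ and all $N\ge1$ $$\sup_{t\in[0,T]}W_1\big(\rho^{E,N}(t),\tilde\rho^{E,N}(t)\big)\le W_1\big(\rho^{E,N}(0),\tilde\rho^{E,N}(0)\big)+2LT\,S_N.$$ Moreover, if $x^N_N(0)=\tilde x^N_N(0)$ for all $N\ge1$ and $\lim_{N\to\infty}S_N=0$, then: (i) if there is $C>0$ such that the total variations on $\mathbb{R}$ of $\rho^{E,N}(0)$ and of $\tilde\rho^{E,N}(0)$ are less than $C$ for all $N\ge1$, then for all $T>0$ $$\lim_{N\to\infty}\ \sup_{t\in[0,T]}\big\|\rho^{E,N}(t)-\tilde\rho^{E,N}(t)\big\|_{L^1(\mathbb{R})}=0;$$ (ii) if the map $\rho\mapsto\rho\,v'(\rho)$ (defined where $v$ is differentiable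 in $(0,1)$) is non-increasing, then for all $T>0$ there is a strictly increasing sequence $(N_k)_k$ with $$\lim_{k\to\infty}\ \sup_{t\in[1/k,T]}\big\|\rho^{E,N_k}(t)-\tilde\rho^{E,N_k}(t)\big\|_{L^1(\mathbb{R})}=0.$$ -/

import Mathlib

open Set Filter Topology MeasureTheory
open scoped NNReal ENNReal

noncomputable section

/-- Standing assumptions on the velocity map `v` (only its values on `[0, 1]` matter, the maximal
density being `1`): `v` is Lipschitz on `[0, 1]` with Lipschitz constant `L`, `v 1 = 0`, and there
is a constant `c < 0` with `v' ≤ c` almost everywhere on `[0, 1]`.  (`deriv v` is `0` where `v` is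
not differentiable, so the inequality includes differentiability.) -/
structure VelocityAssumption (v : ℝ → ℝ) (L : ℝ≥0) : Prop where
  lipschitz : LipschitzOnWith L v (Icc 0 1)
  map_one : v 1 = 0
  deriv_le : ∃ c : ℝ, c < 0 ∧ ∀ᵐ r ∂(volume.restrict (Icc (0 : ℝ) 1)), deriv v r ≤ c

/-- The additional assumption on the velocity: `ρ ↦ ρ v'(ρ)` is non-increasing on `[0, 1]`, on the
set of the points at which the Lipschitz function `v` has a derivative. -/
def VelocityMonotonicity (v : ℝ → ℝ) : Prop :=
  AntitoneOn (fun r => r * deriv v r) {r | r ∈ Ioo (0 : ℝ) 1 ∧ DifferentiableAt ℝ v r}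

/-- The discrete density `ρ_j = l / (x_{j+1} - x_j)` with `l = 1 / N`, at time `t`. -/
def discreteDensity {N : ℕ} (x : Fin (N + 1) → ℝ → ℝ) (j : Fin N) (t : ℝ) : ℝ :=
  (1 / (N : ℝ)) / (x j.succ t - x j.castSucc t)

/-- Solutions on `[0, +∞)` of the Follow-the-Leader system with `N + 1` vehicles whose initial
positions are ordered and have mutual distances at least `l = 1 / N`.

Since `v` is a map on `[0, 1]`, it is evaluated at the projection of the discrete density to
`[0, 1]`; that the discrete density in fact stays in `[0, 1]` is not assumed. -/
structure IsFtLSolution (v : ℝ → ℝ) (N : ℕ) (x : Fin (N + 1) → ℝ → ℝ) : Prop where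
  initial_gap : ∀ j : Fin N, 1 / (N : ℝ) ≤ x j.succ 0 - x j.castSucc 0
  leader : ∀ t : ℝ, 0 ≤ t → HasDerivWithinAt (x (Fin.last N)) (v 0) (Ici 0) t
  follower : ∀ j : Fin N, ∀ t : ℝ, 0 ≤ t →
    HasDerivWithinAt (x j.castSucc)
      (v (projIcc (0 : ℝ) 1 zero_le_one (discreteDensity x j t))) (Ici 0) t

/-- All initial positions, for all numbers of vehicles, lie in one bounded set. -/
def UniformlyBoundedInitialSupport (x : (N : ℕ) → Fin (N + 1) → ℝ → ℝ) : Prop :=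
  ∃ K : Set ℝ, Bornology.IsBounded K ∧ ∀ N : ℕ, 1 ≤ N → ∀ i : Fin (N + 1), x N i 0 ∈ K

/-- The Eulerian discrete density `ρ^{E,N}(t, ·)`. -/
def eulerianDensity {N : ℕ} (x : Fin (N + 1) → ℝ → ℝ) (t : ℝ) (y : ℝ) : ℝ :=
  ∑ j : Fin N, (Ico (x j.castSucc t) (x j.succ t)).indicator (fun _ => discreteDensity x j t) y

/-- The measure on the real line with density `ρ^{E,N}(t, ·)`. -/
def eulerianMeasure {N : ℕ} (x : Fin (N + 1) → ℝ → ℝ) (t : ℝ) : Measure ℝ :=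
  volume.withDensity (fun y => ENNReal.ofReal (eulerianDensity x t y))

/-- The cumulative distribution `F_μ(y) = μ((-∞, y])`. -/
def cumulative (μ : Measure ℝ) (y : ℝ) : ℝ := μ.real (Iic y)

/-- The one-dimensional 1-Wasserstein distance of two compactly supported probability measures,
`W₁(μ, ν) = ‖F_μ - F_ν‖_{L¹(ℝ)}`. -/
def wassersteinOne (μ ν : Measure ℝ) : ℝ≥0∞ :=
  eLpNorm (fun y => cumulative μ y - cumulative ν y) 1 volume

/-- `W₁(ρ^{E,N}(t), ρ̃^{E,N}(t))`. -/
def wassersteinEulerian {N : ℕ} (x z : Fin (N + 1) → ℝ → ℝ) (t : ℝ) : ℝ≥0∞ :=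
  wassersteinOne (eulerianMeasure x t) (eulerianMeasure z t)

/-- `‖ρ^{E,N}(t) - ρ̃^{E,N}(t)‖_{L¹(ℝ)}`. -/
def lOneEulerian {N : ℕ} (x z : Fin (N + 1) → ℝ → ℝ) (t : ℝ) : ℝ≥0∞ :=
  eLpNorm (fun y => eulerianDensity x t y - eulerianDensity z t y) 1 volume

/-- `∑_{j=0}^{N-1} |x_{j+1}(0) - x_j(0) - (x̃_{j+1}(0) - x̃_j(0))|`. -/
def initialGapDifference {N : ℕ} (x z : Fin (N + 1) → ℝ → ℝ) : ℝ :=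
  ∑ j : Fin N, |x j.succ 0 - x j.castSucc 0 - (z j.succ 0 - z j.castSucc 0)|

/-- The total variation on `ℝ` of `ρ^{E,N}(0, ·)`. -/
def initialTotalVariation {N : ℕ} (x : Fin (N + 1) → ℝ → ℝ) : ℝ≥0∞ :=
  eVariationOn (eulerianDensity x 0) univ

end

noncomputable section


/-! ### The velocity map -/

/-! Everything rests on an ℓ¹ contraction. For two solutions the gap differences satisfy `d_j' =
p_{j+1} - p_j`, where `p_j` is the difference of the speeds of vehicle `j`. Speed increases with the
gap, so `p_j` has the sign of `d_j`; leaders share one speed, so the last `p` vanishes. Hence `∑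
|d_j|` does not increase (`sum_abs_le_of_hasDerivWithinAt`) and stays below `S_N`.

Speed is `L N`-Lipschitz in the gap, so the position differences drift by at most `L N S_N t` in
total. The monotone coupling, which matches points with equal mass to their left, writes `W₁` as `1
/ N` times a sum over cells of integrated position differences (`wassersteinEulerian_eq`); this
gives the first estimate.

If the leaders coincide, all positions differ by at most `S_N`. Shifting each jump of one density to
the matching vehicle of the other, then correcting the cell values, bounds the `L¹` distance by `(TV
+ 1) S_N` (`lOneEulerian_le`). It remains to bound the variation at time `t`. In (i) it does not
increase, by the same contraction applied to the density jumps. In (ii) a discrete Oleinik estimate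
(`mul_vehicleSpeed_sub_le_gap`) bounds it by a constant plus a multiple of `1 / t`, uniformly in
`N`, and a diagonal choice of `N_k` absorbs the growth as `t` approaches `0`. -/

theorem LipschitzOnWith.sub_le_mul_of_ae_deriv_le {f : ℝ → ℝ} {K : ℝ≥0} {a b c : ℝ}
    (hf : LipschitzOnWith K f (Icc a b)) (hab : a ≤ b)
    (hc : ∀ᵐ x ∂(volume.restrict (Icc a b)), deriv f x ≤ c) :
    f b - f a ≤ c * (b - a) := by
  have hac : AbsolutelyContinuousOnInterval f a b := by
    apply LipschitzOnWith.absolutelyContinuousOnInterval (K := K)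
    rwa [uIcc_of_le hab]
  rw [← hac.integral_deriv_eq_sub]
  calc ∫ x in a..b, deriv f x ≤ ∫ _ in a..b, c :=
        intervalIntegral.integral_mono_ae_restrict hab hac.intervalIntegrable_deriv
          (by simp) hc
    _ = c * (b - a) := by simp [mul_comm]

theorem ae_comp_const_mul {p : ℝ → Prop} (hp : ∀ᵐ x, p x) {a : ℝ} (ha : a ≠ 0) :
    ∀ᵐ x, p (a * x) := by
  rw [ae_iff] at hp ⊢
  have := Real.volume_preimage_mul_left ha {x | ¬ p x}
  rw [hp, mul_zero] at this
  exact this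

namespace VelocityAssumption

variable {v : ℝ → ℝ} {L : ℝ≥0}

/-- Integrating `v' ≤ c` makes `v` quantitatively invertible, so that variation of the speeds will
control variation of the densities. -/
theorem exists_mul_sub_le (hv : VelocityAssumption v L) :
    ∃ c : ℝ, 0 < c ∧ ∀ r s : ℝ, 0 ≤ r → r ≤ s → s ≤ 1 → c * (s - r) ≤ v r - v s := by
  obtain ⟨c, hc, hd⟩ := hv.deriv_le
  refine ⟨-c, by linarith, fun r s hr hrs hs => ?_⟩
  have hsub : Icc r s ⊆ Icc 0 1 := Icc_subset_Icc hr hs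
  have := (hv.lipschitz.mono hsub).sub_le_mul_of_ae_deriv_le hrs (c := c)
    (ae_mono (Measure.restrict_mono hsub le_rfl) hd)
  linarith

theorem antitoneOn (hv : VelocityAssumption v L) : AntitoneOn v (Icc 0 1) := by
  obtain ⟨c, hc, h⟩ := hv.exists_mul_sub_le
  intro r hr s hs hrs
  have := h r s hr.1 hrs hs.2
  nlinarith [mul_nonneg hc.le (sub_nonneg.2 hrs)]

/-- Times `r`, the derivative is `r v'(r) - (μ r) v'(μ r)`, which is nonpositive because `μ r ≤ r`.
This integrated form no longer mentions `v'`. -/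
theorem antitoneOn_sub_comp_mul (hv : VelocityAssumption v L) (hm : VelocityMonotonicity v)
    {μ : ℝ} (hμ : 0 < μ) (hμ1 : μ ≤ 1) : AntitoneOn (fun r => v r - v (μ * r)) (Icc 0 1) := by
  obtain ⟨c, hc, hd⟩ := hv.deriv_le
  rw [ae_restrict_iff' measurableSet_Icc] at hd
  have hmul : LipschitzOnWith 1 (fun r : ℝ => μ * r) (Icc 0 1) := by
    apply LipschitzOnWith.of_dist_le_mul
    intro r _ s _
    rw [Real.dist_eq, Real.dist_eq, ← mul_sub, abs_mul, abs_of_pos hμ]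
    simpa using mul_le_mul_of_nonneg_right hμ1 (abs_nonneg (r - s))
  have hmaps : MapsTo (fun r : ℝ => μ * r) (Icc 0 1) (Icc 0 1) := fun r hr =>
    ⟨mul_nonneg hμ.le hr.1, mul_le_one₀ hμ1 hr.1 hr.2⟩
  have hlip := hv.lipschitz.sub (hv.lipschitz.comp hmul hmaps)
  intro r hr s hs hrs
  have hsub : Icc r s ⊆ Icc 0 1 := Icc_subset_Icc hr.1 hs.2
  have key := (hlip.mono hsub).sub_le_mul_of_ae_deriv_le hrs (c := 0) ?_
  · simp only [Function.comp, zero_mul] at key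
    dsimp only
    linarith
  rw [ae_restrict_iff' measurableSet_Icc]
  have h0 : ∀ᵐ q : ℝ, q ≠ 0 := by simp [ae_iff]
  have h1 : ∀ᵐ q : ℝ, q ≠ 1 := by simp [ae_iff]
  filter_upwards [hd, ae_comp_const_mul hd hμ.ne', h0, h1] with q hq hq' hq0 hq1 hqm
  have hqI := hsub hqm
  have hpos : 0 < q := lt_of_le_of_ne hqI.1 hq0.symm
  have hlt : q < 1 := lt_of_le_of_ne hqI.2 hq1
  have hμq : μ * q ≤ q := mul_le_of_le_one_left hpos.le hμ1
  have hμpos : 0 < μ * q := mul_pos hμ hpos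
  -- A negative value of `deriv` rules out its default value `0`, hence differentiability.
  have d1 : DifferentiableAt ℝ v q :=
    differentiableAt_of_deriv_ne_zero (by linarith [hq hqI])
  have d2 : DifferentiableAt ℝ v (μ * q) :=
    differentiableAt_of_deriv_ne_zero (by linarith [hq' (hmaps hqI)])
  have hder : HasDerivAt (fun r => v r - (v ∘ fun r => μ * r) r)
      (deriv v q - deriv v (μ * q) * μ) q := by
    refine d1.hasDerivAt.sub (HasDerivAt.comp q d2.hasDerivAt ?_)
    simpa using (hasDerivAt_id q).const_mul μ
  have hmono := hm (a := μ * q) (b := q) ⟨⟨hμpos, hμq.trans_lt hlt⟩, d2⟩ ⟨⟨hpos, hlt⟩, d1⟩ hμq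
  change deriv (fun r => v r - (v ∘ fun r => μ * r) r) q ≤ 0
  rw [hder.deriv]
  dsimp only at hmono
  by_contra! hcon
  nlinarith [mul_pos hpos hcon]

end VelocityAssumption

/-! ### The velocity as a function of the gap to the preceding vehicle -/

/-- The velocity of a vehicle at distance `g` from the preceding one, when `l` is the mass of a
vehicle. -/
def gapSpeed (v : ℝ → ℝ) (l g : ℝ) : ℝ := v (projIcc (0 : ℝ) 1 zero_le_one (l / g))

section gapSpeed

variable {v : ℝ → ℝ} {L : ℝ≥0} {l : ℝ}

theorem gapSpeed_nonneg (hv : VelocityAssumption v L) (g : ℝ) : 0 ≤ gapSpeed v l g := by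
  have := hv.antitoneOn (projIcc (0 : ℝ) 1 zero_le_one (l / g)).2 (right_mem_Icc.2 zero_le_one)
    (projIcc (0 : ℝ) 1 zero_le_one (l / g)).2.2
  rwa [hv.map_one] at this

theorem gapSpeed_le (hv : VelocityAssumption v L) (g : ℝ) : gapSpeed v l g ≤ v 0 :=
  hv.antitoneOn (left_mem_Icc.2 zero_le_one) (projIcc (0 : ℝ) 1 zero_le_one (l / g)).2
    (projIcc (0 : ℝ) 1 zero_le_one (l / g)).2.1

theorem VelocityAssumption.map_zero_nonneg (hv : VelocityAssumption v L) : 0 ≤ v 0 :=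
  (gapSpeed_nonneg hv (l := 0) 0).trans (gapSpeed_le hv 0)

theorem gapSpeed_eq_zero (hv : VelocityAssumption v L) {g : ℝ} (hg : 0 < g) (hgl : g ≤ l) :
    gapSpeed v l g = 0 := by
  rw [gapSpeed, projIcc_of_right_le _ ((one_le_div hg).2 hgl), hv.map_one]

theorem div_mem_Icc {g : ℝ} (hl : 0 < l) (hg : l ≤ g) : l / g ∈ Icc (0 : ℝ) 1 :=
  ⟨div_nonneg hl.le (hl.le.trans hg), (div_le_one (hl.trans_le hg)).2 hg⟩

theorem gapSpeed_of_le {g : ℝ} (hl : 0 < l) (hg : l ≤ g) : gapSpeed v l g = v (l / g) := by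
  rw [gapSpeed, projIcc_of_mem _ (div_mem_Icc hl hg)]

theorem gapSpeed_monotoneOn (hv : VelocityAssumption v L) (hl : 0 < l) :
    MonotoneOn (gapSpeed v l) (Ioi 0) := by
  intro a ha b _ hab
  refine hv.antitoneOn (Subtype.coe_prop _) (Subtype.coe_prop _) ?_
  exact monotone_projIcc _ (div_le_div_of_nonneg_left hl.le ha hab)

theorem abs_div_sub_div {a b : ℝ} (hl : 0 < l) (ha : l ≤ a) (hb : l ≤ b) :
    |l / a - l / b| = l / (a * b) * |a - b| := by
  have ha' := hl.trans_le ha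
  have hb' := hl.trans_le hb
  have h : l / a - l / b = l / (a * b) * (b - a) := by field_simp
  rw [h, abs_mul, abs_of_pos (by positivity), abs_sub_comm]

/-- On `[l, ∞)` the map `g ↦ l / g` is `1 / l`-Lipschitz, since `a b ≥ l²`. -/
theorem abs_gapSpeed_sub_le (hv : VelocityAssumption v L) (hl : 0 < l) {a b : ℝ}
    (ha : l ≤ a) (hb : l ≤ b) : |gapSpeed v l a - gapSpeed v l b| ≤ L / l * |a - b| := by
  rw [gapSpeed_of_le hl ha, gapSpeed_of_le hl hb]
  have h := hv.lipschitz.dist_le_mul _ (div_mem_Icc hl ha) _ (div_mem_Icc hl hb)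
  rw [Real.dist_eq, Real.dist_eq, abs_div_sub_div hl ha hb] at h
  refine h.trans ?_
  have ha' := hl.trans_le ha
  have hb' := hl.trans_le hb
  have : l / (a * b) ≤ 1 / l := by
    rw [div_le_div_iff₀ (by positivity) hl, one_mul]
    exact mul_le_mul ha hb hl.le ha'.le
  calc (L : ℝ) * (l / (a * b) * |a - b|) ≤ L * (1 / l * |a - b|) := by gcongr
    _ = L / l * |a - b| := by ring

/-- Multiplying a gap by `μ` divides the density by `μ`. The inequality is concavity of the speed in
the logarithm of the gap, the form used in the Oleinik estimate. -/
theorem gapSpeed_mul_sub_le (hv : VelocityAssumption v L) (hm : VelocityMonotonicity v)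
    (hl : 0 < l) {a b μ : ℝ} (ha : l ≤ a) (hab : a ≤ b) (hμ : 1 ≤ μ) :
    gapSpeed v l (μ * b) - gapSpeed v l b ≤ gapSpeed v l (μ * a) - gapSpeed v l a := by
  have hb := ha.trans hab
  have ha0 := hl.trans_le ha
  have hb0 := hl.trans_le hb
  have hμ0 : 0 < μ := by linarith
  rw [gapSpeed_of_le hl ha, gapSpeed_of_le hl hb,
    gapSpeed_of_le hl (ha.trans (le_mul_of_one_le_left ha0.le hμ)),
    gapSpeed_of_le hl (hb.trans (le_mul_of_one_le_left hb0.le hμ))]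
  have h := hv.antitoneOn_sub_comp_mul hm (inv_pos.2 hμ0) (inv_le_one_of_one_le₀ hμ)
    (div_mem_Icc hl hb) (div_mem_Icc hl ha) (div_le_div_of_nonneg_left hl.le ha0 hab)
  have e (g : ℝ) : μ⁻¹ * (l / g) = l / (μ * g) := by
    rw [inv_mul_eq_div, div_div, mul_comm]
  simp only [e] at h
  linarith

end gapSpeed

/-! ### Contraction of one-sided difference systems -/

/-- To first order in `h`, `|d_j|` loses `|p_j| h` and gains at most `|p_{j+1}| h`. The sum
telescopes to `(|p_n| - |p_0|) h ≤ 0`. Used both for gap differences and for density jumps. -/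
theorem sum_abs_le_of_hasDerivWithinAt {n : ℕ} {d : Fin n → ℝ → ℝ} {p : Fin (n + 1) → ℝ → ℝ}
    (hd : ∀ j, ∀ t, 0 ≤ t →
      HasDerivWithinAt (d j) (p j.succ t - p j.castSucc t) (Ici 0) t)
    (hlast : ∀ t, 0 ≤ t → p (Fin.last n) t = 0)
    (hsign : ∀ j, ∀ t, 0 ≤ t → ∃ a, 0 ≤ a ∧ p j.castSucc t = a * d j t) {t : ℝ} (ht : 0 ≤ t) :
    ∑ j, |d j t| ≤ ∑ j, |d j 0| := by
  have hcont : ContinuousOn (fun s => ∑ j, |d j s|) (Icc 0 t) :=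
    continuousOn_finsetSum _ fun j _ => ContinuousOn.abs fun s hs =>
      ((hd j s hs.1).continuousWithinAt).mono Icc_subset_Ici_self
  refine image_le_of_liminf_slope_right_le_deriv_boundary (B := fun _ => ∑ j, |d j 0|)
    (B' := fun _ => 0) hcont le_rfl continuousOn_const
    (fun s _ => hasDerivWithinAt_const _ _ _) ?_ (right_mem_Icc.2 ht)
  intro s hs r hr
  choose a ha hpa using fun j => hsign j s hs.1
  have hslope : Tendsto (fun z => ∑ j, |slope (d j) s z - (p j.succ s - p j.castSucc s)|)
      (𝓝[>] s) (𝓝 0) := by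
    rw [show (0 : ℝ) = ∑ j : Fin n, |(p j.succ s - p j.castSucc s)
      - (p j.succ s - p j.castSucc s)| by simp]
    refine tendsto_finsetSum _ fun j _ => Tendsto.abs (Tendsto.sub_const ?_ _)
    have := (hd j s hs.1).mono (Ici_subset_Ici.2 hs.1)
    exact (hasDerivWithinAt_iff_tendsto_slope' (by simp)).1 (hasDerivWithinAt_Ioi_iff_Ici.2 this)
  -- For such `z`, subtracting `p_j (z - s)` shrinks `d_j` without reversing its sign, so the loss
  -- is exact, also where `d_j = 0`.
  have hsmall : ∀ᶠ z in 𝓝[>] s, ∀ j, a j * (z - s) ≤ 1 := by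
    rw [eventually_all]
    intro j
    have : Tendsto (fun z => a j * (z - s)) (𝓝[>] s) (𝓝 (a j * (s - s))) :=
      tendsto_nhdsWithin_of_tendsto_nhds (by fun_prop : Continuous fun z => a j * (z - s)).continuousAt
    rw [sub_self, mul_zero] at this
    exact (this.eventually_lt_const one_pos).mono fun _ h => h.le
  refine Eventually.frequently ?_
  filter_upwards [hslope.eventually_lt_const hr, hsmall, self_mem_nhdsWithin] with z h1 h2 hz
  have hz0 : 0 < z - s := sub_pos.2 hz
  refine lt_of_le_of_lt ?_ h1
  rw [slope_def_field, div_le_iff₀ hz0, ← Finset.sum_sub_distrib]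
  have hterm : ∀ j, |d j z| - |d j s| ≤
      |slope (d j) s z - (p j.succ s - p j.castSucc s)| * (z - s)
        + (|p j.succ s| - |p j.castSucc s|) * (z - s) := by
    intro j
    have e : d j z = (slope (d j) s z - (p j.succ s - p j.castSucc s)) * (z - s)
        + p j.succ s * (z - s) + (d j s - p j.castSucc s * (z - s)) := by
      rw [slope_def_field]
      field_simp
      ring
    have e2 : |d j s - p j.castSucc s * (z - s)| = |d j s| - |p j.castSucc s| * (z - s) := by
      rw [hpa j, show d j s - a j * d j s * (z - s) = (1 - a j * (z - s)) * d j s by ring,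
        abs_mul, abs_mul, abs_of_nonneg (sub_nonneg.2 (h2 j)), abs_of_nonneg (ha j)]
      ring
    have := (abs_add_le ((slope (d j) s z - (p j.succ s - p j.castSucc s)) * (z - s)
      + p j.succ s * (z - s)) (d j s - p j.castSucc s * (z - s))).trans
      (add_le_add_left (abs_add_le _ _) _)
    rw [← e, e2, abs_mul, abs_mul, abs_of_pos hz0] at this
    linarith
  refine (Finset.sum_le_sum fun j _ => hterm j).trans ?_
  rw [Finset.sum_add_distrib, ← Finset.sum_mul, ← Finset.sum_mul, Finset.sum_sub_distrib]
  have htel : (∑ j : Fin n, |p j.succ s|) - ∑ j : Fin n, |p j.castSucc s| ≤ 0 := by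
    have h3 := Fin.sum_univ_succ fun i => |p i s|
    have h4 := Fin.sum_univ_castSucc fun i => |p i s|
    simp only [hlast s hs.1, abs_zero] at h4
    linarith [abs_nonneg (p 0 s)]
  nlinarith [mul_nonneg (neg_nonneg.2 htel) hz0.le]

theorem MonotoneOn.exists_nonneg_mul_sub {f : ℝ → ℝ} {s : Set ℝ} (hf : MonotoneOn f s) {x y : ℝ}
    (hx : x ∈ s) (hy : y ∈ s) : ∃ a, 0 ≤ a ∧ f x - f y = a * (x - y) := by
  refine ⟨(f x - f y) / (x - y), ?_, ?_⟩
  · rcases le_total x y with h | h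
    · exact div_nonneg_of_nonpos (sub_nonpos.2 (hf hx hy h)) (sub_nonpos.2 h)
    · exact div_nonneg (sub_nonneg.2 (hf hy hx h)) (sub_nonneg.2 h)
  · rcases eq_or_ne x y with rfl | h
    · simp
    · rw [div_mul_cancel₀ _ (sub_ne_zero.2 h)]


/-! ### Solutions of the Follow-the-Leader system -/

/-- The distance from vehicle `j` to the preceding one. -/
def gap {N : ℕ} (x : Fin (N + 1) → ℝ → ℝ) (j : Fin N) (t : ℝ) : ℝ :=
  x j.succ t - x j.castSucc t

/-- The discrete density ahead of each vehicle, which is `0` for the leader. -/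
def vehicleDensity {N : ℕ} (x : Fin (N + 1) → ℝ → ℝ) (i : Fin (N + 1)) (t : ℝ) : ℝ :=
  Fin.snoc (α := fun _ => ℝ) (fun j => discreteDensity x j t) 0 i

/-- The velocity prescribed to each vehicle by the Follow-the-Leader system. -/
def vehicleSpeed (v : ℝ → ℝ) {N : ℕ} (x : Fin (N + 1) → ℝ → ℝ) (i : Fin (N + 1)) (t : ℝ) : ℝ :=
  v (projIcc (0 : ℝ) 1 zero_le_one (vehicleDensity x i t))

/-- The discrete densities, extended by `0` behind the last vehicle and ahead of the leader. -/
def extendedDensity {N : ℕ} (x : Fin (N + 1) → ℝ → ℝ) (i : Fin (N + 2)) (t : ℝ) : ℝ :=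
  Fin.cons (α := fun _ => ℝ) 0 (fun k => vehicleDensity x k t) i

/-- The jump of the Eulerian discrete density at a vehicle. -/
def densityJump {N : ℕ} (x : Fin (N + 1) → ℝ → ℝ) (i : Fin (N + 1)) (t : ℝ) : ℝ :=
  extendedDensity x i.succ t - extendedDensity x i.castSucc t

section

variable {N : ℕ} (x : Fin (N + 1) → ℝ → ℝ) (t : ℝ)

@[simp] theorem vehicleDensity_castSucc (j : Fin N) :
    vehicleDensity x j.castSucc t = discreteDensity x j t := by
  simp [vehicleDensity]

@[simp] theorem vehicleDensity_last : vehicleDensity x (Fin.last N) t = 0 := by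
  simp [vehicleDensity]

@[simp] theorem vehicleSpeed_castSucc (v : ℝ → ℝ) (j : Fin N) :
    vehicleSpeed v x j.castSucc t = gapSpeed v (1 / N) (gap x j t) := by
  simp [vehicleSpeed, gapSpeed, discreteDensity, gap]

@[simp] theorem vehicleSpeed_last (v : ℝ → ℝ) : vehicleSpeed v x (Fin.last N) t = v 0 := by
  simp [vehicleSpeed]

@[simp] theorem extendedDensity_zero : extendedDensity x 0 t = 0 := rfl

@[simp] theorem extendedDensity_succ (i : Fin (N + 1)) :
    extendedDensity x i.succ t = vehicleDensity x i t := rfl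

theorem densityJump_zero : densityJump x 0 t = vehicleDensity x 0 t := by
  rw [densityJump, extendedDensity_succ, Fin.castSucc_zero, extendedDensity_zero, sub_zero]

theorem densityJump_succ (j : Fin N) :
    densityJump x j.succ t = vehicleDensity x j.succ t - vehicleDensity x j.castSucc t := by
  rw [densityJump, extendedDensity_succ, ← Fin.succ_castSucc, extendedDensity_succ]

end

/-! ### Real-variable inequalities behind the position and Oleinik estimates -/

theorem abs_le_abs_last_add_sum {n : ℕ} (y : Fin (n + 1) → ℝ) (i : Fin (n + 1)) :
    |y i| ≤ |y (Fin.last n)| + ∑ j : Fin n, |y j.succ - y j.castSucc| := by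
  induction n with
  | zero => simp [Fin.fin_one_eq_zero i]
  | succ n ih =>
    have key (k : Fin (n + 1)) : |y k.succ| + |y 1 - y 0| ≤
        |y (Fin.last (n + 1))| + ∑ j : Fin (n + 1), |y j.succ - y j.castSucc| := by
      have := ih (fun k => y k.succ) k
      rw [Fin.sum_univ_succ]
      simp only [Fin.succ_last, Fin.succ_castSucc, Fin.castSucc_zero, Fin.succ_zero_eq_one] at this ⊢
      linarith
    refine Fin.cases ?_ (fun k => ?_) i
    · have h1 := key 0
      have h2 := abs_sub_abs_le_abs_sub (y 0) (y 1)
      rw [abs_sub_comm] at h2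
      rw [Fin.succ_zero_eq_one] at h1
      linarith
    · linarith [key k, abs_nonneg (y 1 - y 0)]

/-- If `s f'(s) ≤ f(s)`, then `f(s) / s` is non-increasing. -/
theorem mul_le_mul_of_mul_deriv_le {f f' : ℝ → ℝ} {a b : ℝ} (ha : 0 < a) (hab : a ≤ b)
    (hf : ∀ s, 0 ≤ s → HasDerivWithinAt f (f' s) (Ici 0) s)
    (h : ∀ s, a < s → s < b → s * f' s ≤ f s) : a * f b ≤ b * f a := by
  have hat : ∀ s, 0 < s → HasDerivAt (fun s => f s / s) ((f' s * s - f s * 1) / s ^ 2) s :=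
    fun s hs => ((hf s hs.le).hasDerivAt (Ici_mem_nhds hs)).div (hasDerivAt_id s) hs.ne'
  have hanti : AntitoneOn (fun s => f s / s) (Icc a b) := by
    refine antitoneOn_of_deriv_nonpos (convex_Icc a b) ?_ ?_ ?_
    · exact fun s hs => (hat s (ha.trans_le hs.1)).continuousAt.continuousWithinAt
    · rw [interior_Icc]
      exact fun s hs => (hat s (ha.trans hs.1)).differentiableAt.differentiableWithinAt
    · rw [interior_Icc]
      intro s hs
      rw [(hat s (ha.trans hs.1)).deriv]
      apply div_nonpos_of_nonpos_of_nonneg _ (sq_nonneg s)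
      linarith [h s hs.1 hs.2]
  have := hanti (left_mem_Icc.2 hab) (right_mem_Icc.2 hab) hab
  dsimp only at this
  rw [div_le_div_iff₀ (ha.trans_le hab) ha] at this
  linarith

/-- A one-sided bound for `g' = A - B` when the increments of `A` are at most those of `B`
wherever `g' > 0` and `g` grows at least linearly. -/
theorem mul_deriv_le_self {g A B : ℝ → ℝ} (h0 : 0 ≤ g 0)
    (hg : ∀ t, 0 ≤ t → HasDerivWithinAt g (A t - B t) (Ici 0) t)
    (hA : ContinuousOn A (Ici 0)) (hB : ContinuousOn B (Ici 0)) (hpos : ∀ t, 0 ≤ t → 0 ≤ g t)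
    (H : ∀ a b, 0 < a → a ≤ b → B a < A a → b * g a ≤ a * g b → A b - A a ≤ B b - B a)
    {t : ℝ} (ht : 0 ≤ t) : t * (A t - B t) ≤ g t := by
  by_contra! hcon
  set q : ℝ → ℝ := fun s => s * (A s - B s) - g s with hq
  have hgc : ContinuousOn g (Ici 0) := fun s hs => (hg s hs).continuousWithinAt
  have hqc : ContinuousOn q (Ici 0) := (continuousOn_id.mul (hA.sub hB)).sub hgc
  have hqcI : ContinuousOn q (Icc 0 t) := hqc.mono Icc_subset_Ici_self
  have hcomp : IsCompact (Icc 0 t ∩ q ⁻¹' Iic 0) :=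
    isCompact_Icc.of_isClosed_subset (hqcI.preimage_isClosed_of_isClosed isClosed_Icc isClosed_Iic)
      inter_subset_left
  -- The last time with `q ≤ 0`. Afterwards `q > 0`, so `g' > 0` and `g(s) / s` is non-decreasing:
  -- exactly where `H` applies, making `g'` non-increasing.
  obtain ⟨t0, ⟨ht0, hqt0⟩, hmax⟩ := hcomp.exists_isGreatest
    ⟨0, ⟨left_mem_Icc.2 ht, by simpa [hq] using h0⟩⟩
  have hqt : 0 < q t := by simp only [hq]; linarith
  have hlt : t0 < t := lt_of_le_of_ne ht0.2 (by rintro rfl; exact absurd hqt0 (not_le.2 hqt))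
  have hposq : ∀ s, t0 < s → s ≤ t → 0 < q s := by
    intro s hs hst
    by_contra! hcon'
    exact absurd (hmax ⟨⟨ht0.1.trans hs.le, hst⟩, hcon'⟩) (not_le.2 hs)
  have hanti : ∀ a b, t0 < a → a ≤ b → b ≤ t → A b - B b ≤ A a - B a := by
    intro a b ha hab hb
    have ha0 : 0 < a := ht0.1.trans_lt ha
    have hqa := hposq a ha (hab.trans hb)
    have hBA : B a < A a := by
      by_contra! hle
      have : a * (A a - B a) ≤ 0 := mul_nonpos_of_nonneg_of_nonpos ha0.le (by linarith)
      simp only [hq] at hqa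
      linarith [hpos a ha0.le]
    have hgrow : a * -g b ≤ b * -g a := by
      refine mul_le_mul_of_mul_deriv_le (f := fun s => -g s) (f' := fun s => -(A s - B s)) ha0 hab
        (fun s hs => (hg s hs).neg) fun s hs hsb => ?_
      have := hposq s (ha.trans hs) (hsb.le.trans hb)
      simp only [hq] at this
      linarith
    linarith [H a b ha0 hab hBA (by linarith)]
  -- Formally `q' = s g'' ≤ 0`. As `g'` is only known to be monotone, the mean value theorem
  -- replaces `g''`; letting `a` tend to `t0` then contradicts `q t > 0`.
  have hle : ∀ a ∈ Ioo t0 t, q t ≤ q a := by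
    intro a ha
    have ha0 : 0 < a := ht0.1.trans_lt ha.1
    obtain ⟨ξ, hξ, hslope⟩ := exists_hasDerivAt_eq_slope g (fun s => A s - B s) ha.2
      (hgc.mono fun s hs => ha0.le.trans hs.1) fun s hs =>
        (hg s (ha0.trans hs.1).le).hasDerivAt (Ici_mem_nhds (ha0.trans hs.1))
    have hξ' := hanti ξ t (ha.1.trans hξ.1) hξ.2.le le_rfl
    have ha' := hanti a t ha.1 ha.2.le le_rfl
    have hta : 0 < t - a := sub_pos.2 ha.2
    rw [hslope, le_div_iff₀ hta] at hξ'
    simp only [hq]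
    nlinarith [mul_le_mul_of_nonneg_left ha' ha0.le]
  have hlim : Tendsto q (𝓝[>] t0) (𝓝 (q t0)) :=
    ((hqc t0 ht0.1).mono fun s hs => ht0.1.trans (le_of_lt hs) : ContinuousWithinAt q (Ioi t0) t0)
  have : q t ≤ q t0 := ge_of_tendsto hlim
    (by filter_upwards [Ioo_mem_nhdsGT hlt] with a ha using hle a ha)
  exact absurd hqt0 (not_le.2 (hqt.trans_le this))

namespace IsFtLSolution

variable {v : ℝ → ℝ} {L : ℝ≥0} {N : ℕ} {x z : Fin (N + 1) → ℝ → ℝ} {t : ℝ}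

theorem hasDerivWithinAt (hx : IsFtLSolution v N x) (i : Fin (N + 1)) (ht : 0 ≤ t) :
    HasDerivWithinAt (x i) (vehicleSpeed v x i t) (Ici 0) t := by
  refine Fin.lastCases ?_ (fun j => ?_) i
  · simpa using hx.leader t ht
  · simpa [vehicleSpeed] using hx.follower j t ht

theorem hasDerivWithinAt_gap (hx : IsFtLSolution v N x) (j : Fin N) (ht : 0 ≤ t) :
    HasDerivWithinAt (gap x j) (vehicleSpeed v x j.succ t - vehicleSpeed v x j.castSucc t)
      (Ici 0) t :=
  (hx.hasDerivWithinAt j.succ ht).sub (hx.hasDerivWithinAt j.castSucc ht)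

theorem continuousOn_gap (hx : IsFtLSolution v N x) (j : Fin N) :
    ContinuousOn (gap x j) (Ici 0) :=
  fun _ hs => (hx.hasDerivWithinAt_gap j hs).continuousWithinAt

theorem vehicleSpeed_nonneg (hv : VelocityAssumption v L) (i : Fin (N + 1)) :
    0 ≤ vehicleSpeed v x i t := by
  refine Fin.lastCases ?_ (fun j => ?_) i
  · simpa using hv.map_zero_nonneg
  · simpa using gapSpeed_nonneg hv _

theorem vehicleSpeed_le (hv : VelocityAssumption v L) (i : Fin (N + 1)) :
    vehicleSpeed v x i t ≤ v 0 := by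
  refine Fin.lastCases ?_ (fun j => ?_) i
  · simp
  · simpa using gapSpeed_le hv _

/-- A follower whose positive gap is at most `l` stands still, while no vehicle moves backwards, so
such a gap cannot shrink. -/
theorem le_gap (hv : VelocityAssumption v L) (hN : 1 ≤ N) (hx : IsFtLSolution v N x) (j : Fin N)
    (ht : 0 ≤ t) : 1 / (N : ℝ) ≤ gap x j t := by
  have hl : 0 < 1 / (N : ℝ) := by positivity
  set l := 1 / (N : ℝ) with hldef
  by_contra! hcon
  -- The barrier is `l - ε (1 + s)`. The first bound keeps the gap positive at contact, which
  -- matters because a nonpositive gap projects to density `0` and full speed; the second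
  -- contradicts the assumed small gap.
  obtain ⟨ε, hε, hε1, hε2⟩ : ∃ ε > 0, ε * (1 + t) < l ∧ ε * (1 + t) < l - gap x j t := by
    have h1 : 0 < min l (l - gap x j t) := lt_min hl (sub_pos.2 hcon)
    refine ⟨min l (l - gap x j t) / 2 / (1 + t), by positivity, ?_⟩
    rw [div_mul_cancel₀ _ (by positivity)]
    exact ⟨by linarith [min_le_left l (l - gap x j t)],
      by linarith [min_le_right l (l - gap x j t)]⟩
  have key := image_le_of_deriv_right_lt_deriv_boundary' (f := fun s => -gap x j s)
    (f' := fun s => -(vehicleSpeed v x j.succ s - vehicleSpeed v x j.castSucc s))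
    (B := fun s => -l + ε * (1 + s)) (B' := fun _ => ε) (a := 0) (b := t)
    ((hx.continuousOn_gap j).neg.mono Icc_subset_Ici_self)
    (fun s hs => ((hx.hasDerivWithinAt_gap j hs.1).mono (Ici_subset_Ici.2 hs.1)).neg)
    (by
      have := hx.initial_gap j
      simp only [gap]
      linarith)
    (by fun_prop)
    (fun s _ => by
      simpa using (((hasDerivAt_id s).const_add 1).const_mul ε |>.const_add (-l)).hasDerivWithinAt)
    ?_ (right_mem_Icc.2 ht)
  · linarith
  · intro s hs hs'
    have hst : ε * (1 + s) ≤ ε * (1 + t) := by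
      have := hs.2.le
      gcongr
    have hεs : 0 ≤ ε * (1 + s) := mul_nonneg hε.le (by linarith [hs.1])
    have h0 : vehicleSpeed v x j.castSucc s = 0 := by
      rw [vehicleSpeed_castSucc]
      exact gapSpeed_eq_zero hv (by linarith) (by linarith)
    rw [h0]
    linarith [vehicleSpeed_nonneg hv (x := x) (t := s) j.succ]

theorem vehicleDensity_mem_Icc (hv : VelocityAssumption v L) (hN : 1 ≤ N)
    (hx : IsFtLSolution v N x) (i : Fin (N + 1)) (ht : 0 ≤ t) :
    vehicleDensity x i t ∈ Icc (0 : ℝ) 1 := by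
  refine Fin.lastCases ?_ (fun j => ?_) i
  · simp
  · rw [vehicleDensity_castSucc]
    exact div_mem_Icc (by positivity) (hx.le_gap hv hN j ht)

theorem vehicleSpeed_eq (hv : VelocityAssumption v L) (hN : 1 ≤ N)
    (hx : IsFtLSolution v N x) (i : Fin (N + 1)) (ht : 0 ≤ t) :
    vehicleSpeed v x i t = v (vehicleDensity x i t) := by
  rw [vehicleSpeed, projIcc_of_mem _ (hx.vehicleDensity_mem_Icc hv hN i ht)]

theorem gap_pos (hv : VelocityAssumption v L) (hN : 1 ≤ N) (hx : IsFtLSolution v N x) (j : Fin N)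
    (ht : 0 ≤ t) : 0 < gap x j t :=
  lt_of_lt_of_le (by positivity) (hx.le_gap hv hN j ht)

theorem strictMono (hv : VelocityAssumption v L) (hN : 1 ≤ N) (hx : IsFtLSolution v N x)
    (ht : 0 ≤ t) : StrictMono fun i => x i t :=
  Fin.strictMono_iff_lt_succ.2 fun j => sub_pos.1 (hx.gap_pos hv hN j ht)

/-! ### Stability of the gaps and of the positions -/

theorem sum_abs_gap_sub_le (hv : VelocityAssumption v L) (hN : 1 ≤ N) (hx : IsFtLSolution v N x)
    (hz : IsFtLSolution v N z) (ht : 0 ≤ t) :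
    ∑ j, |gap x j t - gap z j t| ≤ initialGapDifference x z := by
  refine sum_abs_le_of_hasDerivWithinAt (d := fun j s => gap x j s - gap z j s)
    (p := fun i s => vehicleSpeed v x i s - vehicleSpeed v z i s) (fun j s hs => ?_)
    (fun s _ => by simp) (fun j s hs => ?_) ht
  · have := (hx.hasDerivWithinAt_gap j hs).sub (hz.hasDerivWithinAt_gap j hs)
    exact this.congr_deriv (by ring)
  · simp only [vehicleSpeed_castSucc]
    exact (gapSpeed_monotoneOn hv (by positivity)).exists_nonneg_mul_sub
      (hx.gap_pos hv hN j hs) (hz.gap_pos hv hN j hs)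

theorem sum_abs_vehicleSpeed_sub_le (hv : VelocityAssumption v L) (hN : 1 ≤ N)
    (hx : IsFtLSolution v N x) (hz : IsFtLSolution v N z) (ht : 0 ≤ t) :
    ∑ i, |vehicleSpeed v x i t - vehicleSpeed v z i t| ≤ L * N * initialGapDifference x z := by
  rw [Fin.sum_univ_castSucc]
  simp only [vehicleSpeed_last, sub_self, abs_zero, add_zero, vehicleSpeed_castSucc]
  calc ∑ j, |gapSpeed v (1 / N) (gap x j t) - gapSpeed v (1 / N) (gap z j t)|
      ≤ ∑ j, L * N * |gap x j t - gap z j t| := by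
        refine Finset.sum_le_sum fun j _ => ?_
        refine (abs_gapSpeed_sub_le hv (by positivity) (hx.le_gap hv hN j ht)
          (hz.le_gap hv hN j ht)).trans_eq ?_
        simp
    _ ≤ _ := by
        rw [← Finset.mul_sum]
        exact mul_le_mul_of_nonneg_left (hx.sum_abs_gap_sub_le hv hN hz ht) (by positivity)

theorem sum_abs_increment_sub_le (hv : VelocityAssumption v L) (hN : 1 ≤ N)
    (hx : IsFtLSolution v N x) (hz : IsFtLSolution v N z) (ht : 0 ≤ t) :
    ∑ i, |x i t - z i t - (x i 0 - z i 0)| ≤ L * N * initialGapDifference x z * t := by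
  set e : Fin (N + 1) → ℝ → ℝ := fun i s => x i s - z i s - (x i 0 - z i 0) with he
  -- Signs are frozen at the final time, so the sum to be differentiated is linear in `e`.
  set σ : Fin (N + 1) → ℝ := fun i => SignType.sign (e i t) with hσ
  have hσ1 : ∀ i, |σ i| ≤ 1 := by
    intro i
    rcases lt_trichotomy (e i t) 0 with h | h | h <;> simp [hσ, h]
  have hder : ∀ s, 0 ≤ s → HasDerivWithinAt (fun s => ∑ i, σ i * e i s)
      (∑ i, σ i * (vehicleSpeed v x i s - vehicleSpeed v z i s)) (Ici 0) s := by
    intro s hs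
    refine HasDerivWithinAt.fun_sum fun i _ => HasDerivWithinAt.const_mul _ ?_
    exact ((hx.hasDerivWithinAt i hs).sub (hz.hasDerivWithinAt i hs)).sub_const _
  have key := image_le_of_deriv_right_le_deriv_boundary (f := fun s => ∑ i, σ i * e i s)
    (f' := fun s => ∑ i, σ i * (vehicleSpeed v x i s - vehicleSpeed v z i s))
    (B := fun s => L * N * initialGapDifference x z * s)
    (B' := fun _ => L * N * initialGapDifference x z) (a := 0) (b := t)
    (fun s hs => ((hder s hs.1).continuousWithinAt).mono Icc_subset_Ici_self)
    (fun s hs => (hder s hs.1).mono (Ici_subset_Ici.2 hs.1)) (by simp [he]) (by fun_prop)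
    (fun s _ => by simpa using ((hasDerivAt_id s).const_mul _).hasDerivWithinAt)
    (fun s hs => ?_) (right_mem_Icc.2 ht)
  · refine le_trans (Finset.sum_le_sum fun i _ => ?_) key
    simp only [hσ]
    rw [sign_mul_self]
  · refine le_trans (Finset.sum_le_sum fun i _ => ?_)
      (hx.sum_abs_vehicleSpeed_sub_le hv hN hz hs.1)
    refine (le_abs_self _).trans ?_
    rw [abs_mul]
    exact mul_le_of_le_one_left (abs_nonneg _) (hσ1 i)

theorem leader_eq (hx : IsFtLSolution v N x) (ht : 0 ≤ t) :
    x (Fin.last N) t = x (Fin.last N) 0 + v 0 * t := by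
  have hder : ∀ s, 0 ≤ s → HasDerivWithinAt (fun s => x (Fin.last N) s - v 0 * s) 0 (Ici 0) s := by
    intro s hs
    have := (hx.leader s hs).sub ((hasDerivAt_id s).const_mul (v 0)).hasDerivWithinAt
    exact this.congr_deriv (by simp)
  have := constant_of_has_deriv_right_zero (a := 0) (b := t)
    (fun s hs => ((hder s hs.1).continuousWithinAt).mono Icc_subset_Ici_self)
    (fun s hs => (hder s hs.1).mono (Ici_subset_Ici.2 hs.1)) t (right_mem_Icc.2 ht)
  simp only [mul_zero, sub_zero] at this
  linarith

theorem initial_le (hv : VelocityAssumption v L) (hx : IsFtLSolution v N x) (i : Fin (N + 1))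
    (ht : 0 ≤ t) : x i 0 ≤ x i t := by
  have := image_le_of_deriv_right_le_deriv_boundary (f := fun s => - x i s)
    (f' := fun s => - vehicleSpeed v x i s) (B := fun _ => - x i 0) (B' := fun _ => 0)
    (a := 0) (b := t)
    (fun s hs => ((hx.hasDerivWithinAt i hs.1).neg.continuousWithinAt).mono Icc_subset_Ici_self)
    (fun s hs => ((hx.hasDerivWithinAt i hs.1).mono (Ici_subset_Ici.2 hs.1)).neg) le_rfl
    continuousOn_const (fun s _ => hasDerivWithinAt_const _ _ _)
    (fun s _ => neg_nonpos.2 (vehicleSpeed_nonneg hv i)) (right_mem_Icc.2 ht)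
  exact neg_le_neg_iff.1 this

theorem abs_position_sub_le (hv : VelocityAssumption v L) (hN : 1 ≤ N)
    (hx : IsFtLSolution v N x) (hz : IsFtLSolution v N z)
    (hlead : x (Fin.last N) 0 = z (Fin.last N) 0) (i : Fin (N + 1)) (ht : 0 ≤ t) :
    |x i t - z i t| ≤ initialGapDifference x z := by
  refine (abs_le_abs_last_add_sum (fun i => x i t - z i t) i).trans ?_
  rw [hx.leader_eq ht, hz.leader_eq ht, hlead, sub_self, abs_zero, zero_add]
  refine le_trans (Finset.sum_le_sum fun j _ => le_of_eq ?_) (hx.sum_abs_gap_sub_le hv hN hz ht)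
  rw [gap, gap]
  congr 1
  ring

/-! ### Total variation of the discrete density -/

/-- Since `ρ_j' = (l / g_j²) (v(ρ_j) - v(ρ_{j+1}))` and `v` decreases, `ρ_j'` has the sign of the
jump `ρ_{j+1} - ρ_j`. The contraction lemma applies with `p` the time derivatives of the densities,
zero at both ends. -/
theorem sum_abs_densityJump_le_initial (hv : VelocityAssumption v L) (hN : 1 ≤ N)
    (hx : IsFtLSolution v N x) (ht : 0 ≤ t) :
    ∑ i, |densityJump x i t| ≤ ∑ i, |densityJump x i 0| := by
  set ρ' : Fin N → ℝ → ℝ := fun j s =>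
    1 / (N : ℝ) / gap x j s ^ 2 * (-v (vehicleDensity x j.succ s) - -v (vehicleDensity x j.castSucc s))
    with hρ'
  set q : Fin (N + 1) → ℝ → ℝ := fun i s =>
    Fin.snoc (α := fun _ => ℝ) (fun j => ρ' j s) 0 i with hq
  set p : Fin (N + 2) → ℝ → ℝ := fun i s =>
    Fin.cons (α := fun _ => ℝ) 0 (fun k => q k s) i with hp
  have hqd : ∀ i s, 0 ≤ s → HasDerivWithinAt (vehicleDensity x i) (q i s) (Ici 0) s := by
    intro i s hs
    refine Fin.lastCases ?_ (fun j => ?_) i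
    · have : vehicleDensity x (Fin.last N) = fun _ => 0 := funext fun s => vehicleDensity_last x s
      rw [this]
      simpa [hq] using hasDerivWithinAt_const s (Ici 0) (0 : ℝ)
    · have : vehicleDensity x j.castSucc = fun s => 1 / (N : ℝ) / gap x j s :=
        funext fun s => vehicleDensity_castSucc x s j
      rw [this]
      have := (hasDerivWithinAt_const s (Ici 0) (1 / (N : ℝ))).div (hx.hasDerivWithinAt_gap j hs)
        (hx.gap_pos hv hN j hs).ne'
      refine this.congr_deriv ?_
      simp only [hq, Fin.snoc_castSucc, hρ', hx.vehicleSpeed_eq hv hN _ hs]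
      ring
  have hpd : ∀ i s, 0 ≤ s → HasDerivWithinAt (extendedDensity x i) (p i s) (Ici 0) s := by
    intro i s hs
    refine Fin.cases ?_ (fun k => ?_) i
    · exact hasDerivWithinAt_const s (Ici 0) (0 : ℝ)
    · exact hqd k s hs
  refine sum_abs_le_of_hasDerivWithinAt (d := densityJump x) (p := p)
    (fun i s hs => (hpd i.succ s hs).sub (hpd i.castSucc s hs)) (fun s _ => ?_) (fun i s hs => ?_) ht
  · rw [← Fin.succ_last]
    simp [hp, hq]
  · refine Fin.cases ⟨0, le_rfl, by simp [hp]⟩ (fun j => ?_) i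
    obtain ⟨a, ha, hav⟩ := hv.antitoneOn.neg.exists_nonneg_mul_sub
      (hx.vehicleDensity_mem_Icc hv hN j.succ hs) (hx.vehicleDensity_mem_Icc hv hN j.castSucc hs)
    have hg := hx.gap_pos hv hN j hs
    refine ⟨1 / (N : ℝ) / gap x j s ^ 2 * a, by positivity, ?_⟩
    rw [densityJump_succ, ← Fin.succ_castSucc]
    simp only [hp, Fin.cons_succ, hq, Fin.snoc_castSucc, hρ']
    rw [mul_assoc, ← hav]

/-- The discrete one-sided Lipschitz estimate `(v_{j+1} - v_j) / (x_{j+1} - x_j) ≤ 1 / t`. -/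
theorem mul_vehicleSpeed_sub_le_gap (hv : VelocityAssumption v L) (hm : VelocityMonotonicity v)
    (hN : 1 ≤ N) (hx : IsFtLSolution v N x) (j : Fin N) (ht : 0 ≤ t) :
    t * (vehicleSpeed v x j.succ t - vehicleSpeed v x j.castSucc t) ≤ gap x j t := by
  have hl : 0 < 1 / (N : ℝ) := by positivity
  have hmono := gapSpeed_monotoneOn hv hl
  have hcont : ∀ i, ContinuousOn (vehicleSpeed v x i) (Ici 0) := by
    intro i
    refine Fin.lastCases ?_ (fun j => ?_) i
    · rw [show vehicleSpeed v x (Fin.last N) = fun _ => v 0 from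
        funext fun s => vehicleSpeed_last x s v]
      exact continuousOn_const
    · rw [show vehicleSpeed v x j.castSucc = fun s =>
        v (projIcc (0 : ℝ) 1 zero_le_one (1 / (N : ℝ) / gap x j s)) from
        funext fun s => vehicleSpeed_castSucc x s v j]
      refine hv.lipschitz.continuousOn.comp ?_ fun s _ => Subtype.coe_prop _
      refine (continuous_subtype_val.comp continuous_projIcc).comp_continuousOn ?_
      exact continuousOn_const.div (hx.continuousOn_gap j) fun s hs => (hx.gap_pos hv hN j hs).ne'
  -- Indexing by vehicles allows induction backwards from the leader, whose own case is vacuous.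
  suffices h : ∀ i : Fin (N + 1), ∀ j : Fin N, i = j.castSucc → ∀ t, 0 ≤ t →
      t * (vehicleSpeed v x j.succ t - vehicleSpeed v x j.castSucc t) ≤ gap x j t from
    h _ j rfl t ht
  intro i
  induction i using Fin.reverseInduction with
  | last => exact fun j hj => absurd hj.symm (Fin.castSucc_lt_last j).ne
  | cast k ih =>
    intro j hj t ht
    obtain rfl := Fin.castSucc_injective _ hj
    refine mul_deriv_le_self (hx.gap_pos hv hN k le_rfl).le
      (fun s hs => hx.hasDerivWithinAt_gap k hs) (hcont _) (hcont _)
      (fun s hs => (hx.gap_pos hv hN k hs).le) (fun a b ha hab hlt hgrow => ?_) ht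
    have hb := ha.trans_le hab
    have hga := hx.gap_pos hv hN k ha.le
    have hgb := hx.gap_pos hv hN k hb.le
    have hμ : 1 ≤ b / a := (one_le_div ha).2 hab
    have hμ0 : 0 < b / a := by positivity
    have hgrow' : b / a * gap x k a ≤ gap x k b := by
      rw [div_mul_eq_mul_div, div_le_iff₀ ha]
      linarith
    have hV := hmono (mem_Ioi.2 (mul_pos hμ0 hga)) (mem_Ioi.2 hgb) hgrow'
    rw [vehicleSpeed_castSucc] at hlt
    rw [vehicleSpeed_castSucc, vehicleSpeed_castSucc]
    rcases Fin.eq_castSucc_or_eq_last k.succ with ⟨m, hm'⟩ | hlast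
    · rw [hm', vehicleSpeed_castSucc] at hlt
      rw [hm', vehicleSpeed_castSucc, vehicleSpeed_castSucc]
      have hma := hx.gap_pos hv hN m ha.le
      have hmb := hx.gap_pos hv hN m hb.le
      have hle : gap x k a ≤ gap x m a := by
        by_contra! hcon
        exact absurd (hmono hma hga hcon.le) (not_le.2 hlt)
      have hgm : gap x m b ≤ b / a * gap x m a := by
        rw [div_mul_eq_mul_div, le_div_iff₀ ha, mul_comm (gap x m b)]
        exact mul_le_mul_of_mul_deriv_le ha hab (fun s hs => hx.hasDerivWithinAt_gap m hs)
          fun s hs _ => ih m hm' s (ha.trans hs).le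
      -- With `μ = b / a`, the gap ahead grows at most by the factor `μ` (induction) and the own gap
      -- at least by `μ`. The faster vehicle ahead has the larger gap, so log-concavity bounds its
      -- speed gain by that of vehicle `k`.
      have h1 := hmono hmb (mem_Ioi.2 (mul_pos hμ0 hma)) hgm
      have h2 := gapSpeed_mul_sub_le hv hm hl (hx.le_gap hv hN k ha.le) hle hμ
      linarith
    · rw [hlast, vehicleSpeed_last, vehicleSpeed_last]
      have := hmono hga hgb ((le_mul_of_one_le_left hga.le hμ).trans hgrow')
      linarith

/-- An upper bound on increments controls absolute variation: if `D ≤ G` and `0 ≤ G`, then `|D| ≤ 2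
G - D`. Here `G` is gap over `t`, and both sums telescope. The leading `1` bounds the jump at the
rearmost vehicle. -/
theorem sum_abs_densityJump_le (hv : VelocityAssumption v L) (hm : VelocityMonotonicity v)
    (hN : 1 ≤ N) (hx : IsFtLSolution v N x) {c : ℝ} (hc : 0 < c)
    (hvc : ∀ r s : ℝ, 0 ≤ r → r ≤ s → s ≤ 1 → c * (s - r) ≤ v r - v s) (ht : 0 < t) :
    ∑ i, |densityJump x i t| ≤ 1 + 2 / c * ((x (Fin.last N) 0 - x 0 0) / t + v 0) := by
  set w := vehicleSpeed v x with hw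
  have hr := fun i => hx.vehicleDensity_mem_Icc hv hN i ht.le
  rw [Fin.sum_univ_succ, densityJump_zero, abs_of_nonneg (hr 0).1]
  refine add_le_add (hr 0).2 ?_
  have hinv : ∀ r s : ℝ, r ∈ Icc (0 : ℝ) 1 → s ∈ Icc (0 : ℝ) 1 → c * |r - s| ≤ |v r - v s| := by
    intro r s hr hs
    rcases le_total r s with h | h
    · rw [abs_sub_comm, abs_of_nonneg (sub_nonneg.2 h)]
      exact (hvc r s hr.1 h hs.2).trans (le_abs_self _)
    · rw [abs_of_nonneg (sub_nonneg.2 h), abs_sub_comm]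
      exact (hvc s r hs.1 h hr.2).trans (le_abs_self _)
  have hstep : ∀ j : Fin N, c * |densityJump x j.succ t| ≤
      2 * (gap x j t / t) - (w j.succ t - w j.castSucc t) := by
    intro j
    have hO := hx.mul_vehicleSpeed_sub_le_gap hv hm hN j ht.le
    rw [mul_comm, ← le_div_iff₀ ht] at hO
    have hg : 0 ≤ gap x j t / t := div_nonneg (hx.gap_pos hv hN j ht.le).le ht.le
    have h1 := hinv _ _ (hr j.succ) (hr j.castSucc)
    rw [← densityJump_succ, ← hx.vehicleSpeed_eq hv hN _ ht.le,
      ← hx.vehicleSpeed_eq hv hN _ ht.le] at h1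
    refine h1.trans ?_
    rw [abs_le]
    constructor <;> linarith
  have htel (f : Fin (N + 1) → ℝ) :
      ∑ j : Fin N, (f j.succ - f j.castSucc) = f (Fin.last N) - f 0 := by
    have h3 := Fin.sum_univ_succ f
    have h4 := Fin.sum_univ_castSucc f
    rw [Finset.sum_sub_distrib]
    linarith
  have hsum := Finset.sum_le_sum fun j (_ : j ∈ Finset.univ) => hstep j
  rw [← Finset.mul_sum, Finset.sum_sub_distrib, ← Finset.mul_sum, ← Finset.sum_div,
    htel fun i => w i t] at hsum
  have hgap : ∑ j, gap x j t = x (Fin.last N) t - x 0 t := htel fun i => x i t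
  rw [hgap, hx.leader_eq ht.le] at hsum
  have h0 := hx.initial_le hv 0 ht.le
  have hw0 : w 0 t ≤ w (Fin.last N) t := by
    simpa [hw] using vehicleSpeed_le hv (x := x) (t := t) 0
  have hfrac : (x (Fin.last N) 0 + v 0 * t - x 0 t) / t ≤ (x (Fin.last N) 0 - x 0 0) / t + v 0 := by
    rw [div_add' _ _ _ ht.ne']
    gcongr
    linarith
  rw [div_mul_eq_mul_div, le_div_iff₀ hc]
  linarith

end IsFtLSolution


/-! ### The Wasserstein distance through a monotone coupling -/

theorem enorm_measureReal_sub_eq_of_subset {Ω : Type*} [MeasurableSpace Ω] {ν : Measure Ω}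
    [IsFiniteMeasure ν] {s t : Set Ω} (hs : MeasurableSet s) (hst : s ⊆ t) :
    ‖ν.real t - ν.real s‖ₑ = ν (t \ s) := by
  rw [← measureReal_sdiff hst hs, Real.enorm_eq_ofReal measureReal_nonneg, ofReal_measureReal]

/-- If `a` and `b` are comonotone, the `L¹` distance of their distribution functions is the `L¹`
distance of `a` and `b`. -/
theorem lintegral_enorm_measureReal_sub_eq {Ω : Type*} [MeasurableSpace Ω] {ν : Measure Ω}
    [IsFiniteMeasure ν] {a b : Ω → ℝ} (ha : Measurable a) (hb : Measurable b)
    (h : ∀ ω ω', (a ω ≤ a ω' ∧ b ω ≤ b ω') ∨ (a ω' ≤ a ω ∧ b ω' ≤ b ω)) :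
    ∫⁻ y, ‖ν.real {ω | a ω ≤ y} - ν.real {ω | b ω ≤ y}‖ₑ = ∫⁻ ω, ‖a ω - b ω‖ₑ ∂ν := by
  set S : Set (ℝ × Ω) := {q | min (a q.2) (b q.2) ≤ q.1 ∧ q.1 < max (a q.2) (b q.2)} with hS
  have hSm : MeasurableSet S :=
    (measurableSet_le (f := fun q : ℝ × Ω => min (a q.2) (b q.2)) (g := fun q => q.1)
      (by fun_prop) (by fun_prop)).inter
      (measurableSet_lt (f := fun q : ℝ × Ω => q.1) (g := fun q => max (a q.2) (b q.2))
        (by fun_prop) (by fun_prop))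
  have h1 : ∀ y, ‖ν.real {ω | a ω ≤ y} - ν.real {ω | b ω ≤ y}‖ₑ =
      ∫⁻ ω, S.indicator 1 (y, ω) ∂ν := by
    intro y
    have e : ∫⁻ ω, S.indicator 1 (y, ω) ∂ν = ν (Prod.mk y ⁻¹' S) := by
      rw [← lintegral_indicator_one (measurable_prodMk_left hSm)]
      rfl
    have hma : MeasurableSet {ω | a ω ≤ y} := measurableSet_le ha measurable_const
    have hmb : MeasurableSet {ω | b ω ≤ y} := measurableSet_le hb measurable_const
    -- Comonotonicity nests the sublevel sets, so the difference of their masses is the mass of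
    -- their symmetric difference, the slice of `S` at `y`. Tonelli then integrates the other
    -- slices.
    have hsub : {ω | a ω ≤ y} ⊆ {ω | b ω ≤ y} ∨ {ω | b ω ≤ y} ⊆ {ω | a ω ≤ y} := by
      by_contra! hcon
      obtain ⟨ω, h1, h2⟩ := not_subset.1 hcon.1
      obtain ⟨ω', h3, h4⟩ := not_subset.1 hcon.2
      simp only [mem_ofPred_eq, not_le] at h1 h2 h3 h4
      rcases h ω ω' with h | h <;> linarith [h.1, h.2]
    rw [e]
    rcases hsub with hsub | hsub
    · rw [← enorm_neg, neg_sub, enorm_measureReal_sub_eq_of_subset hma hsub]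
      congr 1
      ext ω
      have := @hsub ω
      simp only [Set.mem_sdiff, mem_ofPred_eq, mem_preimage, hS, min_le_iff, lt_max_iff, not_le] at this ⊢
      constructor
      · tauto
      · rintro ⟨h5 | h5, h6 | h6⟩
        · exact absurd h5 (not_le.2 h6)
        · exact absurd (this h5) (not_le.2 h6)
        · exact ⟨h5, h6⟩
        · exact absurd h5 (not_le.2 h6)
    · rw [enorm_measureReal_sub_eq_of_subset hmb hsub]
      congr 1
      ext ω
      have := @hsub ω
      simp only [Set.mem_sdiff, mem_ofPred_eq, mem_preimage, hS, min_le_iff, lt_max_iff, not_le] at this ⊢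
      constructor
      · tauto
      · rintro ⟨h5 | h5, h6 | h6⟩
        · exact absurd h5 (not_le.2 h6)
        · exact ⟨h5, h6⟩
        · exact absurd (this h5) (not_le.2 h6)
        · exact absurd h5 (not_le.2 h6)
  have h2 : ∀ ω, ‖a ω - b ω‖ₑ = ∫⁻ y, S.indicator 1 (y, ω) := by
    intro ω
    have e : ∫⁻ y, S.indicator 1 (y, ω) =
        volume (Ico (min (a ω) (b ω)) (max (a ω) (b ω))) := by
      rw [← lintegral_indicator_one measurableSet_Ico]
      rfl
    rw [e, Real.volume_Ico, max_sub_min_eq_abs, abs_sub_comm, ← ofReal_norm, Real.norm_eq_abs]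
  simp_rw [h1, h2]
  refine lintegral_lintegral_swap ?_
  exact ((measurable_one.indicator hSm).comp measurable_id).aemeasurable

/-- The uniform probability measure on the labels `(j, θ)` of the vehicles and of the points
between them. -/
def labelMeasure (N : ℕ) : Measure (Fin N × ℝ) :=
  ENNReal.ofReal (1 / N) • (Measure.count.prod (volume.restrict (Ico 0 1)))

instance (N : ℕ) : IsFiniteMeasure (labelMeasure N) :=
  Measure.smul_finite _ ENNReal.ofReal_ne_top

theorem lintegral_labelMeasure {N : ℕ} {f : Fin N × ℝ → ℝ≥0∞} (hf : Measurable f) :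
    ∫⁻ q, f q ∂(labelMeasure N) =
      ENNReal.ofReal (1 / N) * ∑ j, ∫⁻ θ in Ico (0 : ℝ) 1, f (j, θ) := by
  rw [labelMeasure, lintegral_smul_measure, lintegral_prod _ hf.aemeasurable, lintegral_count,
    tsum_fintype, smul_eq_mul]

/-- The position with label `(j, θ)`, interpolating linearly between vehicles `j` and `j + 1`. -/
def labelPosition {N : ℕ} (x : Fin (N + 1) → ℝ → ℝ) (t : ℝ) (q : Fin N × ℝ) : ℝ :=
  x q.1.castSucc t + q.2 * gap x q.1 t

theorem measurable_labelPosition {N : ℕ} (x : Fin (N + 1) → ℝ → ℝ) (t : ℝ) :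
    Measurable (labelPosition x t) := by
  refine measurable_from_prod_countable_right fun j => ?_
  unfold labelPosition
  fun_prop

section

variable {N : ℕ} {x z : Fin (N + 1) → ℝ → ℝ} {t : ℝ}

theorem discreteDensity_nonneg (hx : ∀ j, 0 < gap x j t) (j : Fin N) :
    0 ≤ discreteDensity x j t :=
  div_nonneg (by positivity) (hx j).le

/-- On each cell the affine parametrization has slope equal to the gap, which cancels the
denominator of the density: the Eulerian measure is the image of the label measure. -/
theorem eulerianMeasure_apply (hx : ∀ j, 0 < gap x j t) {s : Set ℝ} (hs : MeasurableSet s) :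
    eulerianMeasure x t s = labelMeasure N (labelPosition x t ⁻¹' s) := by
  rw [eulerianMeasure, withDensity_apply _ hs, ← lintegral_indicator_one
    (measurable_labelPosition x t hs), lintegral_labelMeasure
    (measurable_one.indicator (measurable_labelPosition x t hs)), Finset.mul_sum]
  have h1 : ∀ y, ENNReal.ofReal (eulerianDensity x t y) =
      ∑ j : Fin N, (Ico (x j.castSucc t) (x j.succ t)).indicator
        (fun _ => ENNReal.ofReal (discreteDensity x j t)) y := by
    intro y
    rw [eulerianDensity, ENNReal.ofReal_sum_of_nonneg fun j _ =>
      indicator_nonneg (fun _ _ => discreteDensity_nonneg hx j) y]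
    refine Finset.sum_congr rfl fun j _ => ?_
    by_cases hy : y ∈ Ico (x j.castSucc t) (x j.succ t) <;> simp [hy]
  simp_rw [h1]
  rw [lintegral_finsetSum _ fun j _ => measurable_const.indicator measurableSet_Ico]
  refine Finset.sum_congr rfl fun j _ => ?_
  rw [lintegral_indicator_const measurableSet_Ico, Measure.restrict_apply measurableSet_Ico]
  have hg := hx j
  have e1 : ∫⁻ θ in Ico (0 : ℝ) 1, (labelPosition x t ⁻¹' s).indicator 1 (j, θ) =
      volume ((fun θ => gap x j t * θ) ⁻¹' ((fun y => x j.castSucc t + y) ⁻¹'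
        (Ico (x j.castSucc t) (x j.succ t) ∩ s))) := by
    have hm : MeasurableSet {θ : ℝ | labelPosition x t (j, θ) ∈ s} :=
      (measurable_labelPosition x t).comp measurable_prodMk_left hs
    calc ∫⁻ θ in Ico (0 : ℝ) 1, (labelPosition x t ⁻¹' s).indicator 1 (j, θ)
        = ∫⁻ θ in Ico (0 : ℝ) 1, {θ : ℝ | labelPosition x t (j, θ) ∈ s}.indicator 1 θ := rfl
      _ = volume ({θ : ℝ | labelPosition x t (j, θ) ∈ s} ∩ Ico 0 1) := by
        rw [lintegral_indicator_one hm, Measure.restrict_apply hm]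
      _ = _ := by
        congr 1
        ext θ
        have h2 : x j.succ t = x j.castSucc t + gap x j t := by rw [gap]; ring
        simp only [labelPosition, mem_inter_iff, mem_ofPred_eq, mem_Ico, mem_preimage, h2,
          le_add_iff_nonneg_right, add_lt_add_iff_left, mul_comm θ, mul_nonneg_iff_of_pos_left hg,
          mul_lt_iff_lt_one_right hg]
        tauto
  rw [e1, Real.volume_preimage_mul_left hg.ne', measure_preimage_add, ← mul_assoc,
    ← ENNReal.ofReal_mul (by positivity), abs_of_pos (inv_pos.2 hg)]
  rfl

theorem labelPosition_comonotone (hx : ∀ j, 0 < gap x j t) (hz : ∀ j, 0 < gap z j t)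
    (q q' : Fin N × ℝ) (hq : q.2 ∈ Icc (0 : ℝ) 1) (hq' : q'.2 ∈ Icc (0 : ℝ) 1) :
    (labelPosition x t q ≤ labelPosition x t q' ∧ labelPosition z t q ≤ labelPosition z t q') ∨
    (labelPosition x t q' ≤ labelPosition x t q ∧ labelPosition z t q' ≤ labelPosition z t q) := by
  have key : ∀ {y : Fin (N + 1) → ℝ → ℝ}, (∀ j, 0 < gap y j t) → ∀ {j k : Fin N} {θ η : ℝ},
      θ ∈ Icc (0 : ℝ) 1 → η ∈ Icc (0 : ℝ) 1 → j < k →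
      labelPosition y t (j, θ) ≤ labelPosition y t (k, η) := by
    intro y hy j k θ η hθ hη hjk
    have hmono : Monotone fun i => y i t :=
      (Fin.strictMono_iff_lt_succ.2 fun j => sub_pos.1 (hy j)).monotone
    have h1 : y j.succ t ≤ y k.castSucc t := hmono (Fin.succ_le_castSucc_iff.2 hjk)
    simp only [labelPosition]
    have h2 : θ * gap y j t ≤ gap y j t := mul_le_of_le_one_left (hy j).le hθ.2
    have h3 : 0 ≤ η * gap y k t := mul_nonneg hη.1 (hy k).le
    simp only [gap] at *
    linarith
  have key2 : ∀ {y : Fin (N + 1) → ℝ → ℝ}, (∀ j, 0 < gap y j t) → ∀ {j : Fin N} {θ η : ℝ},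
      θ ≤ η → labelPosition y t (j, θ) ≤ labelPosition y t (j, η) := by
    intro y hy j θ η h
    exact add_le_add_right (mul_le_mul_of_nonneg_right h (hy j).le) _
  obtain ⟨j, θ⟩ := q
  obtain ⟨k, η⟩ := q'
  rcases lt_trichotomy j k with h | rfl | h
  · exact Or.inl ⟨key hx hq hq' h, key hz hq hq' h⟩
  · rcases le_total θ η with h | h
    · exact Or.inl ⟨key2 hx h, key2 hz h⟩
    · exact Or.inr ⟨key2 hx h, key2 hz h⟩
  · exact Or.inr ⟨key hx hq' hq h, key hz hq' hq h⟩

theorem ae_labelMeasure_mem_Ico (N : ℕ) : ∀ᵐ q ∂(labelMeasure N), q.2 ∈ Ico (0 : ℝ) 1 := by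
  apply Measure.ae_smul_measure
  exact Measure.quasiMeasurePreserving_snd.ae (ae_restrict_mem measurableSet_Ico)

theorem wassersteinEulerian_eq (hx : ∀ j, 0 < gap x j t) (hz : ∀ j, 0 < gap z j t) :
    wassersteinEulerian x z t =
      ENNReal.ofReal (1 / N) * ∑ j, ∫⁻ θ in Ico (0 : ℝ) 1,
        ‖labelPosition x t (j, θ) - labelPosition z t (j, θ)‖ₑ := by
  -- Label positions are comonotone only for `θ ∈ [0, 1]`; clamping gives comonotonicity everywhere
  -- and changes nothing almost everywhere.
  set κ : Fin N × ℝ → Fin N × ℝ := fun q => (q.1, projIcc (0 : ℝ) 1 zero_le_one q.2) with hκ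
  have hκm : Measurable κ := measurable_fst.prodMk
    ((continuous_subtype_val.comp continuous_projIcc).measurable.comp measurable_snd)
  have hκae : ∀ᵐ q ∂(labelMeasure N), κ q = q := by
    filter_upwards [ae_labelMeasure_mem_Ico N] with q hq
    simp [hκ, projIcc_of_mem zero_le_one (Ico_subset_Icc_self hq)]
  have hF : ∀ {y : Fin (N + 1) → ℝ → ℝ}, (∀ j, 0 < gap y j t) → ∀ r,
      cumulative (eulerianMeasure y t) r =
        (labelMeasure N).real {q | labelPosition y t (κ q) ≤ r} := by
    intro y hy r
    rw [cumulative, measureReal_def, measureReal_def, eulerianMeasure_apply hy measurableSet_Iic]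
    congr 1
    apply measure_congr
    filter_upwards [hκae] with q hq
    change (labelPosition y t q ≤ r) = (labelPosition y t (κ q) ≤ r)
    rw [hq]
  have hmx := measurable_labelPosition x t
  have hmz := measurable_labelPosition z t
  rw [wassersteinEulerian, wassersteinOne, eLpNorm_one_eq_lintegral_enorm]
  simp_rw [hF hx, hF hz]
  refine (lintegral_enorm_measureReal_sub_eq (hmx.comp hκm) (hmz.comp hκm) fun q q' =>
    labelPosition_comonotone hx hz (κ q) (κ q') (Subtype.coe_prop _) (Subtype.coe_prop _)).trans ?_
  rw [← lintegral_labelMeasure (f := fun q => ‖labelPosition x t q - labelPosition z t q‖ₑ)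
    (by fun_prop)]
  apply lintegral_congr_ae
  filter_upwards [hκae] with q hq
  simp [hq]

end

theorem IsFtLSolution.wassersteinEulerian_le {v : ℝ → ℝ} {L : ℝ≥0} {N : ℕ}
    {x z : Fin (N + 1) → ℝ → ℝ} {t : ℝ} (hv : VelocityAssumption v L) (hN : 1 ≤ N)
    (hx : IsFtLSolution v N x) (hz : IsFtLSolution v N z) (ht : 0 ≤ t) :
    wassersteinEulerian x z t ≤ wassersteinEulerian x z 0 +
      ENNReal.ofReal (2 * L * t * initialGapDifference x z) := by
  rw [wassersteinEulerian_eq (fun j => hx.gap_pos hv hN j ht) (fun j => hz.gap_pos hv hN j ht),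
    wassersteinEulerian_eq (fun j => hx.gap_pos hv hN j le_rfl)
      (fun j => hz.gap_pos hv hN j le_rfl)]
  set e : Fin (N + 1) → ℝ := fun i => x i t - z i t - (x i 0 - z i 0) with he
  have hpt : ∀ j : Fin N, ∀ θ ∈ Ico (0 : ℝ) 1,
      ‖labelPosition x t (j, θ) - labelPosition z t (j, θ)‖ₑ ≤
        ‖labelPosition x 0 (j, θ) - labelPosition z 0 (j, θ)‖ₑ +
          ENNReal.ofReal (|e j.castSucc| + |e j.succ|) := by
    intro j θ hθ
    simp only [← ofReal_norm, Real.norm_eq_abs]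
    rw [← ENNReal.ofReal_add (abs_nonneg _) (by positivity)]
    apply ENNReal.ofReal_le_ofReal
    have h1 : labelPosition x t (j, θ) - labelPosition z t (j, θ) =
        (labelPosition x 0 (j, θ) - labelPosition z 0 (j, θ)) +
          ((1 - θ) * e j.castSucc + θ * e j.succ) := by
      simp only [labelPosition, gap, he]
      ring
    rw [h1]
    refine (abs_add_le _ _).trans (add_le_add_right ((abs_add_le _ _).trans ?_) _)
    rw [abs_mul, abs_mul, abs_of_nonneg hθ.1, abs_of_nonneg (sub_nonneg.2 hθ.2.le)]
    exact add_le_add (mul_le_of_le_one_left (abs_nonneg _) (by linarith [hθ.1]))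
      (mul_le_of_le_one_left (abs_nonneg _) hθ.2.le)
  have hint : ∀ j : Fin N,
      ∫⁻ θ in Ico (0 : ℝ) 1, ‖labelPosition x t (j, θ) - labelPosition z t (j, θ)‖ₑ ≤
        (∫⁻ θ in Ico (0 : ℝ) 1, ‖labelPosition x 0 (j, θ) - labelPosition z 0 (j, θ)‖ₑ) +
          ENNReal.ofReal (|e j.castSucc| + |e j.succ|) := by
    intro j
    refine (setLIntegral_mono' measurableSet_Ico (hpt j)).trans_eq ?_
    rw [lintegral_add_right _ measurable_const]
    simp
  refine (mul_le_mul_right (Finset.sum_le_sum fun j _ => hint j) _).trans ?_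
  rw [Finset.sum_add_distrib, mul_add]
  refine add_le_add_right ?_ _
  rw [← ENNReal.ofReal_sum_of_nonneg fun j _ => by positivity,
    ← ENNReal.ofReal_mul (by positivity)]
  apply ENNReal.ofReal_le_ofReal
  have hsum := hx.sum_abs_increment_sub_le hv hN hz ht
  have h3 := Fin.sum_univ_succ fun i => |e i|
  have h4 := Fin.sum_univ_castSucc fun i => |e i|
  rw [Finset.sum_add_distrib]
  have hNpos : (0 : ℝ) < N := by exact_mod_cast hN
  -- The factor `2` arises because a vehicle bounds up to two cells; the mass `1 / N` cancels the
  -- `N` of the speed estimate.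
  rw [one_div, inv_mul_le_iff₀ hNpos]
  linarith [abs_nonneg (e 0), abs_nonneg (e (Fin.last N))]


/-! ### The `L¹` distance of Eulerian discrete densities -/

theorem lintegral_enorm_indicator_Ici_sub (a b : ℝ) :
    ∫⁻ y, ‖(Ici a).indicator (1 : ℝ → ℝ) y - (Ici b).indicator 1 y‖ₑ =
      ENNReal.ofReal |a - b| := by
  have h : ∀ y, ‖(Ici a).indicator (1 : ℝ → ℝ) y - (Ici b).indicator 1 y‖ₑ =
      (Ico (min a b) (max a b)).indicator 1 y := by
    intro y
    by_cases ha : a ≤ y <;> by_cases hb : b ≤ y <;>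
      simp [ha, hb, not_lt.2, not_le.1]
  simp_rw [h]
  rw [lintegral_indicator_one measurableSet_Ico, Real.volume_Ico, max_sub_min_eq_abs, abs_sub_comm]

section

variable {N : ℕ} {x z : Fin (N + 1) → ℝ → ℝ} {t : ℝ}

theorem sum_discreteDensity_mul_sub (h : Fin (N + 1) → ℝ) :
    ∑ j, discreteDensity x j t * (h j.castSucc - h j.succ) = ∑ i, densityJump x i t * h i := by
  have h1 : ∑ i : Fin (N + 1), vehicleDensity x i t * h i =
      ∑ j : Fin N, discreteDensity x j t * h j.castSucc := by
    rw [Fin.sum_univ_castSucc]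
    simp
  have h2 : ∑ i : Fin (N + 1), extendedDensity x i.castSucc t * h i =
      ∑ j : Fin N, discreteDensity x j t * h j.succ := by
    rw [Fin.sum_univ_succ]
    simp only [Fin.castSucc_zero, extendedDensity_zero, zero_mul, zero_add, ← Fin.succ_castSucc,
      extendedDensity_succ, vehicleDensity_castSucc]
  simp only [densityJump, sub_mul, mul_sub, Finset.sum_sub_distrib, extendedDensity_succ, h1, h2]

theorem indicator_Ico_eq_sub {a b : ℝ} (hab : a ≤ b) (c y : ℝ) :
    (Ico a b).indicator (fun _ => c) y =
      c * ((Ici a).indicator (1 : ℝ → ℝ) y - (Ici b).indicator 1 y) := by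
  by_cases ha : a ≤ y <;> by_cases hb : b ≤ y <;> simp [indicator_apply, ha, hb]
  all_goals linarith

theorem lOneEulerian_le (hx : ∀ j, 1 / (N : ℝ) ≤ gap x j t) (hz : ∀ j, 1 / (N : ℝ) ≤ gap z j t)
    (hN : 1 ≤ N) :
    lOneEulerian x z t ≤ ENNReal.ofReal
      (∑ i, |densityJump x i t| * |x i t - z i t| + ∑ j, |gap x j t - gap z j t|) := by
  have hl : 0 < 1 / (N : ℝ) := by positivity
  have hx0 : ∀ j, 0 < gap x j t := fun j => hl.trans_le (hx j)
  have hz0 : ∀ j, 0 < gap z j t := fun j => hl.trans_le (hz j)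
  -- The intermediate function puts the density values of `x` on the cells of `z`. By summation by
  -- parts, the first sum moves each jump from `x_i` to `z_i`; the second corrects the values.
  have hpt : ∀ y, eulerianDensity x t y - eulerianDensity z t y =
      ∑ i, densityJump x i t * ((Ici (x i t)).indicator (1 : ℝ → ℝ) y -
        (Ici (z i t)).indicator 1 y) +
      ∑ j : Fin N, (Ico (z j.castSucc t) (z j.succ t)).indicator
        (fun _ => discreteDensity x j t - discreteDensity z j t) y := by
    intro y
    have e1 : eulerianDensity x t y =
        ∑ i, densityJump x i t * (Ici (x i t)).indicator (1 : ℝ → ℝ) y := by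
      rw [eulerianDensity, ← sum_discreteDensity_mul_sub]
      exact Finset.sum_congr rfl fun j _ => indicator_Ico_eq_sub (sub_pos.1 (hx0 j)).le _ _
    have e2 := sum_discreteDensity_mul_sub (x := x) (t := t)
      fun i => (Ici (z i t)).indicator (1 : ℝ → ℝ) y
    have e3 : ∑ j : Fin N, (Ico (z j.castSucc t) (z j.succ t)).indicator
        (fun _ => discreteDensity x j t - discreteDensity z j t) y =
        ∑ i, densityJump x i t * (Ici (z i t)).indicator (1 : ℝ → ℝ) y -
          eulerianDensity z t y := by
      rw [← e2, eulerianDensity, ← Finset.sum_sub_distrib]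
      refine Finset.sum_congr rfl fun j _ => ?_
      simp only [indicator_Ico_eq_sub (sub_pos.1 (hz0 j)).le]
      ring
    simp_rw [mul_sub]
    rw [Finset.sum_sub_distrib, ← e1, e3]
    ring
  rw [lOneEulerian, eLpNorm_one_eq_lintegral_enorm]
  have hle : ∀ y, ‖eulerianDensity x t y - eulerianDensity z t y‖ₑ ≤
      ∑ i, ‖densityJump x i t‖ₑ * ‖(Ici (x i t)).indicator (1 : ℝ → ℝ) y -
        (Ici (z i t)).indicator 1 y‖ₑ +
      ∑ j : Fin N, (Ico (z j.castSucc t) (z j.succ t)).indicator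
        (fun _ => ‖discreteDensity x j t - discreteDensity z j t‖ₑ) y := by
    intro y
    rw [hpt y]
    refine (enorm_add_le _ _).trans (add_le_add ?_ ?_)
    · exact (enorm_sum_le _ _).trans_eq (Finset.sum_congr rfl fun i _ => enorm_mul _ _)
    · exact (enorm_sum_le _ _).trans_eq
        (Finset.sum_congr rfl fun j _ => enorm_indicator_eq_indicator_enorm _ _)
  have hmI : ∀ a : ℝ, Measurable ((Ici a).indicator (1 : ℝ → ℝ)) := fun a =>
    measurable_one.indicator measurableSet_Ici
  have hmD : ∀ a b : ℝ, Measurable fun y =>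
      ‖(Ici a).indicator (1 : ℝ → ℝ) y - (Ici b).indicator 1 y‖ₑ := fun a b =>
    ((hmI a).sub (hmI b)).enorm
  refine (lintegral_mono hle).trans ?_
  rw [lintegral_add_right _ (Finset.measurable_fun_sum _ fun j _ =>
      measurable_const.indicator measurableSet_Ico),
    lintegral_finsetSum _ fun i _ => (hmD _ _).const_mul _,
    lintegral_finsetSum _ fun j _ => measurable_const.indicator measurableSet_Ico,
    ENNReal.ofReal_add (Finset.sum_nonneg fun i _ => by positivity)
      (Finset.sum_nonneg fun i _ => by positivity),
    ENNReal.ofReal_sum_of_nonneg fun i _ => by positivity,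
    ENNReal.ofReal_sum_of_nonneg fun i _ => by positivity]
  refine add_le_add (Finset.sum_le_sum fun i _ => ?_) (Finset.sum_le_sum fun j _ => ?_)
  · rw [lintegral_const_mul _ (hmD _ _), lintegral_enorm_indicator_Ici_sub,
      ENNReal.ofReal_mul (abs_nonneg _), ← ofReal_norm, Real.norm_eq_abs]
  · rw [lintegral_indicator_const measurableSet_Ico, Real.volume_Ico, ← ofReal_norm,
      ← ENNReal.ofReal_mul (norm_nonneg _), Real.norm_eq_abs]
    apply ENNReal.ofReal_le_ofReal
    change |1 / (N : ℝ) / gap x j t - 1 / (N : ℝ) / gap z j t| * gap z j t ≤ _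
    rw [abs_div_sub_div hl (hx j) (hz j)]
    have h1 : 1 / (N : ℝ) / gap x j t ≤ 1 := (div_le_one (hx0 j)).2 (hx j)
    have h2 := (hz0 j).ne'
    have h3 := (hx0 j).ne'
    calc 1 / (N : ℝ) / (gap x j t * gap z j t) * |gap x j t - gap z j t| * gap z j t
        = 1 / (N : ℝ) / gap x j t * |gap x j t - gap z j t| := by field_simp
      _ ≤ _ := mul_le_of_le_one_left (abs_nonneg _) h1

theorem eulerianDensity_apply (hx : StrictMono fun i => x i t) (i : Fin (N + 1)) :
    eulerianDensity x t (x i t) = vehicleDensity x i t := by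
  have hmem : ∀ j : Fin N, x i t ∈ Ico (x j.castSucc t) (x j.succ t) ↔ j.castSucc = i := by
    intro j
    rw [mem_Ico, hx.le_iff_le, hx.lt_iff_lt, ← Fin.le_castSucc_iff]
    exact ⟨fun h => le_antisymm h.1 h.2, fun h => ⟨h.le, h.ge⟩⟩
  simp only [eulerianDensity, indicator_apply, hmem]
  refine Fin.lastCases ?_ (fun k => ?_) i
  · simp [Fin.castSucc_ne_last]
  · simp

theorem eulerianDensity_of_lt (hx : StrictMono fun i => x i t) {y : ℝ} (hy : y < x 0 t) :
    eulerianDensity x t y = 0 := by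
  refine Finset.sum_eq_zero fun j _ => indicator_of_notMem (fun hmem => ?_) _
  have : x 0 t ≤ x j.castSucc t := hx.monotone (Fin.zero_le _)
  linarith [hmem.1]

theorem sum_abs_densityJump_le_initialTotalVariation (hx : StrictMono fun i => x i 0) :
    ENNReal.ofReal (∑ i, |densityJump x i 0|) ≤ initialTotalVariation x := by
  -- Sampling once behind all vehicles and then at each vehicle reads off the extended densities, as
  -- cells are closed on the left. The `min` keeps `u` monotone past the leader.
  set u : ℕ → ℝ := fun n => Nat.casesOn n (x 0 0 - 1) fun k => x (Fin.ofNat (N + 1) (min k N)) 0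
    with hu
  have hval : ∀ k ≤ N, ∀ hk : k < N + 1, u (k + 1) = x ⟨k, hk⟩ 0 := by
    intro k hkN hk
    simp only [hu, min_eq_left hkN]
    congr 1
    exact Fin.ext (Nat.mod_eq_of_lt hk)
  have hmono : Monotone u := by
    refine monotone_nat_of_le_succ fun n => ?_
    rcases n with _ | n
    · rw [hval 0 (Nat.zero_le _) (Nat.succ_pos _)]
      simp [hu]
    · refine hx.monotone ?_
      rw [Fin.le_def, Fin.val_ofNat, Fin.val_ofNat, Nat.mod_eq_of_lt (by omega),
        Nat.mod_eq_of_lt (by omega)]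
      omega
  have hext : ∀ i : Fin (N + 2), eulerianDensity x 0 (u i) = extendedDensity x i 0 := by
    intro i
    refine Fin.cases ?_ (fun k => ?_) i
    · exact eulerianDensity_of_lt hx (by simp [hu])
    · rw [Fin.val_succ, hval k (Nat.lt_succ_iff.1 k.2) k.2, eulerianDensity_apply hx,
        extendedDensity_succ]
  refine le_trans (le_of_eq ?_)
    (eVariationOn.sum_le (f := eulerianDensity x 0) (n := N + 1) hmono fun _ => mem_univ _)
  rw [ENNReal.ofReal_sum_of_nonneg fun i _ => abs_nonneg _, Finset.sum_range]
  refine Finset.sum_congr rfl fun i _ => ?_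
  have h1 := hext i.succ
  have h2 := hext i.castSucc
  rw [Fin.val_succ] at h1
  rw [Fin.val_castSucc] at h2
  rw [h1, h2, edist_dist, Real.dist_eq, densityJump]

end

theorem IsFtLSolution.lOneEulerian_le {v : ℝ → ℝ} {L : ℝ≥0} {N : ℕ}
    {x z : Fin (N + 1) → ℝ → ℝ} {t : ℝ} (hv : VelocityAssumption v L) (hN : 1 ≤ N)
    (hx : IsFtLSolution v N x) (hz : IsFtLSolution v N z)
    (hlead : x (Fin.last N) 0 = z (Fin.last N) 0) (ht : 0 ≤ t) {M : ℝ}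
    (hM : ∑ i, |densityJump x i t| ≤ M) :
    lOneEulerian x z t ≤ ENNReal.ofReal ((M + 1) * initialGapDifference x z) := by
  refine (_root_.lOneEulerian_le (fun j => hx.le_gap hv hN j ht) (fun j => hz.le_gap hv hN j ht)
    hN).trans (ENNReal.ofReal_le_ofReal ?_)
  have h0 : 0 ≤ initialGapDifference x z := Finset.sum_nonneg fun _ _ => abs_nonneg _
  have h1 : ∑ i, |densityJump x i t| * |x i t - z i t| ≤ M * initialGapDifference x z := by
    refine le_trans (Finset.sum_le_sum fun i _ => mul_le_mul_of_nonneg_left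
      (hx.abs_position_sub_le hv hN hz hlead i ht) (abs_nonneg _)) ?_
    rw [← Finset.sum_mul]
    exact mul_le_mul_of_nonneg_right hM h0
  linarith [hx.sum_abs_gap_sub_le hv hN hz ht]

end

/-! ### Stability and convergence of the discrete densities -/

theorem theorem2 (v : ℝ → ℝ) (L : ℝ≥0) (hv : VelocityAssumption v L)
    (x z : (N : ℕ) → Fin (N + 1) → ℝ → ℝ)
    (hx : ∀ N : ℕ, 1 ≤ N → IsFtLSolution v N (x N))
    (hz : ∀ N : ℕ, 1 ≤ N → IsFtLSolution v N (z N))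
    (hxK : UniformlyBoundedInitialSupport x) (hzK : UniformlyBoundedInitialSupport z) :
    (∀ T : ℝ, 0 < T → ∀ N : ℕ, 1 ≤ N →
      (⨆ t ∈ Icc (0 : ℝ) T, wassersteinEulerian (x N) (z N) t) ≤
        wassersteinEulerian (x N) (z N) 0 +
          ENNReal.ofReal (2 * (L : ℝ) * T * initialGapDifference (x N) (z N))) ∧
    ((∀ N : ℕ, 1 ≤ N → x N (Fin.last N) 0 = z N (Fin.last N) 0) →
      Tendsto (fun N : ℕ => initialGapDifference (x N) (z N)) atTop (𝓝 0) →
      ((∃ C : ℝ, 0 < C ∧ ∀ N : ℕ, 1 ≤ N →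
          initialTotalVariation (x N) < ENNReal.ofReal C ∧
          initialTotalVariation (z N) < ENNReal.ofReal C) →
        ∀ T : ℝ, 0 < T →
          Tendsto (fun N : ℕ => ⨆ t ∈ Icc (0 : ℝ) T, lOneEulerian (x N) (z N) t)
            atTop (𝓝 0)) ∧
      (VelocityMonotonicity v →
        ∀ T : ℝ, 0 < T → ∃ φ : ℕ → ℕ, StrictMono φ ∧
          Tendsto (fun k : ℕ =>
              ⨆ t ∈ Icc (1 / (k : ℝ)) T, lOneEulerian (x (φ k)) (z (φ k)) t)
            atTop (𝓝 0))) := by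
  have hS0 : ∀ N, 0 ≤ initialGapDifference (x N) (z N) := fun N =>
    Finset.sum_nonneg fun _ _ => abs_nonneg _
  refine ⟨fun T hT N hN => ?_, fun hlead hS => ⟨?_, fun hm T hT => ?_⟩⟩
  · refine iSup₂_le fun t ht => ((hx N hN).wassersteinEulerian_le hv hN (hz N hN) ht.1).trans ?_
    refine add_le_add_right (ENNReal.ofReal_le_ofReal ?_) _
    have := hS0 N
    have := ht.2
    gcongr
  · rintro ⟨C, hC, hTV⟩ T hT
    have hlim : Tendsto (fun N => ENNReal.ofReal ((C + 1) * initialGapDifference (x N) (z N)))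
        atTop (𝓝 0) := by
      have := ENNReal.tendsto_ofReal (hS.const_mul (C + 1))
      simpa using this
    refine tendsto_of_tendsto_of_tendsto_of_le_of_le' tendsto_const_nhds hlim
      (Eventually.of_forall fun _ => zero_le) ?_
    filter_upwards [eventually_ge_atTop 1] with N hN
    refine iSup₂_le fun t ht => (hx N hN).lOneEulerian_le hv hN (hz N hN) (hlead N hN) ht.1 ?_
    refine ((hx N hN).sum_abs_densityJump_le_initial hv hN ht.1).trans ?_
    exact (ENNReal.ofReal_le_ofReal_iff hC.le).1 ((sum_abs_densityJump_le_initialTotalVariation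
      ((hx N hN).strictMono hv hN le_rfl)).trans (hTV N hN).1.le)
  · obtain ⟨c, hc, hvc⟩ := hv.exists_mul_sub_le
    obtain ⟨K, hK, hxK⟩ := hxK
    set D := Metric.diam K with hD
    have hD0 : 0 ≤ D := Metric.diam_nonneg
    -- A bound on the variation for `t ≥ 1 / k`, uniform in `N`: the initial spread is at most `D`
    -- and `1 / t ≤ k`.
    set M : ℕ → ℝ := fun k => 1 + 2 / c * (D * k + v 0) with hM
    have hM0 : ∀ k, 0 ≤ M k := fun k => by
      have := hv.map_zero_nonneg
      positivity
    have hbound : ∀ N, 1 ≤ N → ∀ k : ℕ, 1 ≤ k → ∀ t ∈ Icc (1 / (k : ℝ)) T,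
        lOneEulerian (x N) (z N) t ≤
          ENNReal.ofReal ((M k + 1) * initialGapDifference (x N) (z N)) := by
      intro N hN k hk t ht
      have hk0 : (0 : ℝ) < k := by exact_mod_cast hk
      have ht0 : 0 < t := lt_of_lt_of_le (by positivity) ht.1
      refine (hx N hN).lOneEulerian_le hv hN (hz N hN) (hlead N hN) ht0.le ?_
      refine ((hx N hN).sum_abs_densityJump_le hv hm hN hc hvc ht0).trans ?_
      have h1 : x N (Fin.last N) 0 - x N 0 0 ≤ D := (le_abs_self _).trans
        (Metric.dist_le_diam_of_mem hK (hxK N hN _) (hxK N hN _))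
      have h2 : (x N (Fin.last N) 0 - x N 0 0) / t ≤ D * k := by
        rw [div_le_iff₀ ht0]
        have h3 : 1 ≤ k * t := by
          have := ht.1
          rw [div_le_iff₀ hk0] at this
          linarith
        nlinarith
      simp only [hM]
      gcongr
    have hsmall : ∀ k : ℕ, ∃ N₀, ∀ N ≥ N₀, 1 ≤ N ∧
        (M k + 1) * initialGapDifference (x N) (z N) ≤ 1 / ((k : ℝ) + 1) := by
      intro k
      have hlim := hS.const_mul (M k + 1)
      rw [mul_zero] at hlim
      have hpos : (0 : ℝ) < 1 / ((k : ℝ) + 1) := by positivity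
      exact eventually_atTop.1 ((eventually_ge_atTop 1).and
        ((hlim.eventually_lt_const hpos).mono fun _ h => h.le))
    obtain ⟨φ, hφ, hφs⟩ := extraction_forall_of_eventually'
      (P := fun k N => 1 ≤ N ∧
        (M k + 1) * initialGapDifference (x N) (z N) ≤ 1 / ((k : ℝ) + 1)) hsmall
    refine ⟨φ, hφ, ?_⟩
    have hlim : Tendsto (fun k : ℕ => ENNReal.ofReal (1 / ((k : ℝ) + 1))) atTop (𝓝 0) := by
      simpa using ENNReal.tendsto_ofReal (tendsto_one_div_add_atTop_nhds_zero_nat (𝕜 := ℝ))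
    refine tendsto_of_tendsto_of_tendsto_of_le_of_le' tendsto_const_nhds hlim
      (Eventually.of_forall fun _ => zero_le) ?_
    filter_upwards [eventually_ge_atTop 1] with k hk
    exact iSup₂_le fun t ht => (hbound _ (hφs k).1 k hk t ht).trans
      (ENNReal.ofReal_le_ofReal (hφs k).2)
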